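/- Consider a queue with Poisson arrivals of rate $\lambda>0$, an infinite waiting room, and $K$ groups of parallel exponential servers; group $k$ has $M_k$ servers, each of which, when turned on, works at rate $\mu_k>0$ and costs $c_k\ge 0$ per unit time. The state is the number $n\in\mathbb N$ of customers in the system (customers may move freely between servers, switching servers on or off costs nothing). An efficient stationary policy $d$ chooses in every state $n$ a vector $d(n)=(d(n,1),\dots,d(n,K))$ of numbers of working servers, with $0\le d(n,k)\le M_k$ and $\sum_k d(n,k)\le n$. Under $d$ the state process $(n_t)_{t\ge 0}$ is the continuous-time Markov chain that jumps from $n$ to $n+1$ at rate $\lambda$ and from $n$ to $n-1$ at rate $\sum_k d(n,k)\mu_k$; its generator is denoted by $B^d$. The cost rate is $f(n,m)=h(n)+\sum_k m_kc_k$, where the holding cost $h:\mathbb N\to\mathbb R$ is increasing (i.e. nondecreasing) and convex (i.e. $h(n+2)-2h(n+1)+h(n)\ge 0$ for all $n$) and $h(n)\to\infty$ as $n\to\infty$. The long-run average cost of $d$ is $\eta^d=\lim_{T\to\infty}\mathbb E\{\frac1T\int_0^T f(n_t,d(n_t))\,dt\}$. Let $d^*$ be an efficient policy whose long-run average cost $\eta^*$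 is finite and minimal among all efficient policies. Let $g^*:\mathbb N\to\mathbb R$ be the performance potential of $d^*$, $$g^*(n)=\lim_{T\to\infty}\mathbb E\Big\{\int_0^T[f(n_t,d^*(n_t))-\eta^*]\,dt\ \Big|\ n_0=n\Big\},\qquad n\in\mathbb N$$ (whenever these limits exist), or, more generally, any relative value function of $d^*$, i.e. any solution of the Poisson equation $f(n,d^*(n))-\eta^*+(B^{d^*}g^*)(n)=0$ for all $n\in\mathbb N$. Then $g^*$ is increasing (nondecreasing) and convex in $n$: $g^*(n+1)\ge g^*(n)$ and $g^*(n+2)-2g^*(n+1)+g^*(n)\ge 0$ for all $n\in\mathbb N$. -/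

import Mathlib

open MeasureTheory Filter Topology

noncomputable section

/-- The data of a group-server queue: Poisson arrival rate `lam`, `K` groups of parallel exponential
servers, group `k` having `M k` servers with service rate `mu k` and operating cost rate `c k` per
working server, and a holding cost rate `h n` when `n` customers are in the system. -/
structure GroupServerQueue where
  K : ℕ
  lam : ℝ
  M : Fin K → ℕ
  mu : Fin K → ℝ
  c : Fin K → ℝ
  h : ℕ → ℝ

/-- Convexity of a real function of a nonnegative integer: nonnegative second differences. -/
def ConvexSeq (u : ℕ → ℝ) : Prop :=
  ∀ n, 0 ≤ u (n + 2) - 2 * u (n + 1) + u n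

namespace GroupServerQueue

variable (Q : GroupServerQueue)

/-- A scheduling action: the number of working servers in each group. -/
abbrev Action : Type := Fin Q.K → ℕ

/-- A stationary policy: a map from states (numbers of customers) to actions. -/
abbrev Policy : Type := ℕ → Q.Action

/-- The efficient actions in state `n`: at most `M k` servers of group `k` are working, and at most
`n` servers in total. -/
def efficientActions (n : ℕ) : Set Q.Action :=
  {m | (∀ k, m k ≤ Q.M k) ∧ ∑ k, m k ≤ n}

/-- The efficient policy space. -/
def efficientPolicies : Set Q.Policy :=
  {d | ∀ n, d n ∈ Q.efficientActions n}

/-- Total service rate of an action. -/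
def serviceRate (m : Q.Action) : ℝ := ∑ k, (m k : ℝ) * Q.mu k

/-- Total cost rate: holding cost plus linear operating cost. -/
def costRate (n : ℕ) (m : Q.Action) : ℝ := Q.h n + ∑ k, (m k : ℝ) * Q.c k

/-- The infinitesimal generator under policy `d`, acting on functions of the state: jumps
`n → n + 1` at rate `lam`, and `n → n - 1` at the total service rate of `d n` (which is `0` in
state `0` for an efficient policy). -/
def generator (d : Q.Policy) (u : ℕ → ℝ) (n : ℕ) : ℝ :=
  Q.lam * (u (n + 1) - u n) + Q.serviceRate (d n) * (u (n - 1) - u n)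

/-- The uniformization constant, a bound for the total jump rate in every state. -/
def unifRate : ℝ := Q.lam + ∑ k, (Q.M k : ℝ) * Q.mu k

/-- The one-step operator `I + B / Λ` of the uniformized chain, where `B` is the generator and
`Λ` the uniformization constant. -/
def unifStep (d : Q.Policy) (u : ℕ → ℝ) (n : ℕ) : ℝ :=
  u n + Q.generator d u n / Q.unifRate

/-- The transition function `(exp (t B)) (i, j)` of the continuous-time Markov chain with the
(bounded) generator `B` of policy `d`, written as
`exp (-Λ t) * ∑ l, (Λ t) ^ l / l! * ((I + B / Λ) ^ l) (i, j)`. -/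
def transProb (d : Q.Policy) (t : ℝ) (i j : ℕ) : ℝ :=
  ∑' l : ℕ, Real.exp (-(Q.unifRate * t)) * (Q.unifRate * t) ^ l / (l.factorial : ℝ) *
    ((Q.unifStep d)^[l] (Pi.single j 1)) i

/-- Under the probability measure `P`, the process `X t`, `t ≥ 0`, is a continuous-time Markov chain
on `ℕ` whose generator is that of policy `d`, started in `n₀`: it is a (jointly) measurable process,
as every process with right-continuous paths is, it starts in `n₀` almost surely, and
`P (X t = j | X u, u ≤ s) = transProb (t - s) (X s) j` for all `0 ≤ s ≤ t`. -/
structure IsMarkovChain {Ω : Type*} [MeasurableSpace Ω] (d : Q.Policy) (n₀ : ℕ)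
    (P : Measure Ω) (X : ℝ → Ω → ℕ) : Prop where
  isProbabilityMeasure : IsProbabilityMeasure P
  measurable : Measurable fun p : ℝ × Ω => X p.1 p.2
  initial : ∀ᵐ ω ∂P, X 0 ω = n₀
  markov : ∀ s t : ℝ, 0 ≤ s → s ≤ t → ∀ (j : ℕ) (A : Set Ω),
    MeasurableSet[⨆ u ∈ Set.Icc 0 s, MeasurableSpace.comap (X u) ⊤] A →
      P.real (A ∩ {ω | X t ω = j}) = ∫ ω in A, Q.transProb d (t - s) (X s ω) j ∂P

variable {Ω : Type*} [MeasurableSpace Ω]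

/-- `η` is the (finite) long-run average cost of policy `d`: from every initial state `n`, the
expected total cost up to any finite time is finite and
`η = lim_{T → ∞} E_n [(1 / T) ∫_0^T f (n_t, d (n_t)) dt]`.
Here `P d n` is the law governing the process `X` under policy `d` and initial state `n`. -/
def HasAverageCost (P : Q.Policy → ℕ → Measure Ω) (X : ℝ → Ω → ℕ) (d : Q.Policy) (η : ℝ) : Prop :=
  ∀ n : ℕ,
    (∀ T : ℝ, Integrable (fun p : ℝ × Ω => Q.costRate (X p.1 p.2) (d (X p.1 p.2)))
      ((volume.restrict (Set.Ioc 0 T)).prod (P d n))) ∧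
    Tendsto (fun T : ℝ =>
      ∫ ω, (1 / T) * (∫ t in (0 : ℝ)..T, Q.costRate (X t ω) (d (X t ω))) ∂(P d n)) atTop (𝓝 η)

/-- `d` is an optimal policy, with finite optimal long-run average cost `η`: it is an efficient
policy, and no efficient policy has a smaller long-run average cost (policies with infinite
long-run average cost do not compete). -/
structure IsOptimal (P : Q.Policy → ℕ → Measure Ω) (X : ℝ → Ω → ℕ) (d : Q.Policy) (η : ℝ) :
    Prop where
  efficient : d ∈ Q.efficientPolicies
  hasAverageCost : Q.HasAverageCost P X d η
  le : ∀ d' ∈ Q.efficientPolicies, ∀ η' : ℝ, Q.HasAverageCost P X d' η' → η ≤ η'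

/-- `g` is the performance potential of policy `d` with long-run average cost `η`:
`g n = E_n ∫_0^∞ [f (n_t, d (n_t)) - η] dt`, as the limit of the expectations up to time `T`. -/
def IsPotential (P : Q.Policy → ℕ → Measure Ω) (X : ℝ → Ω → ℕ) (d : Q.Policy) (η : ℝ)
    (g : ℕ → ℝ) : Prop :=
  ∀ n : ℕ, Tendsto (fun T : ℝ =>
    ∫ ω, (∫ t in (0 : ℝ)..T, (Q.costRate (X t ω) (d (X t ω)) - η)) ∂(P d n)) atTop (𝓝 (g n))

/-- `g` is a relative value function of policy `d` with long-run average cost `η`: it solves the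
Poisson equation `f - η 1 + B g = 0`. -/
def IsRelativeValue (d : Q.Policy) (η : ℝ) (g : ℕ → ℝ) : Prop :=
  ∀ n : ℕ, Q.costRate n (d n) - η + Q.generator d g n = 0

end GroupServerQueue

end

/-! Let `G n = g n - g (n - 1)`. If the policy attains the best action in every state, the Poisson
equation reads `lam * G (n + 1) = η - h n + maxGain n (G n)`, where `maxGain n x` is the best net
profit from `n` customers when a service completion is worth `x`. The marginal profit of one more
customer decreases in `n` and increases in `x` (`maxGain_succ_sub_le`), and `h` is convex. Hence a
first descent of `G` would be followed by descents at least as large, driving `G` to `-∞`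
(`monotone_of_optimality`). So `G` is nondecreasing once it is known to be eventually nonnegative;
as `G 0 = 0`, this gives both claims.

Two points need probability. Eventual nonnegativity comes from pairing the Poisson equation with the
limiting law `p` (`law_sum_eq`): the flux `a * p M * (g (M + 1) - g M)` is minus a partial sum of
`(f - η) p`, and these partial sums are eventually at most `0`. The optimality equation comes from
strict policy improvement (`IsOptimal.not_improvable`): `g` is then bounded below, so the drift
inequality makes the improved policy stable with average cost at most `η - ε * p m`. This needs `p m
> 0`, which is why `IsOptimal.serviceRate_pos` must rule out idling states first.

Everything is computed with the one-step operator of the uniformized chain. Continuous time enters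
through Poisson mixtures of its iterates, which also show that a potential solves the Poisson
equation. -/

noncomputable section

/-! ### Birth-death step operator: positivity, monotonicity, convergence of means. -/

/-- One step of a birth-death chain on `ℕ`, acting on functions: up with probability `a`, and down
from `n` with probability `b n`. -/
def bdStep (a : ℝ) (b : ℕ → ℝ) : (ℕ → ℝ) →ₗ[ℝ] (ℕ → ℝ) where
  toFun u n := u n + a * (u (n + 1) - u n) + b n * (u (n - 1) - u n)
  map_add' u v := by ext n; simp only [Pi.add_apply]; ring
  map_smul' c u := by ext n; simp only [Pi.smul_apply, smul_eq_mul, RingHom.id_apply]; ring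

/-- The parameters of a birth-death chain with positive up-probability and no step down from `0`,
whose step is stochastically monotone. -/
structure IsBirthDeath (a : ℝ) (b : ℕ → ℝ) : Prop where
  pos : 0 < a
  nonneg : ∀ n, 0 ≤ b n
  le_one : ∀ n, a + b n ≤ 1
  zero : b 0 = 0

theorem bdStep_apply (a : ℝ) (b u : ℕ → ℝ) (n : ℕ) :
    bdStep a b u n = u n + a * (u (n + 1) - u n) + b n * (u (n - 1) - u n) := rfl

namespace IsBirthDeath

variable {a : ℝ} {b : ℕ → ℝ}

theorem step_const (c : ℝ) : bdStep a b (fun _ => c) = fun _ => c := by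
  ext n; simp [bdStep_apply]

theorem iterate_const (c : ℝ) (l : ℕ) : (bdStep a b)^[l] (fun _ => c) = fun _ => c :=
  Function.iterate_fixed (step_const c) l

theorem iterate_smul (c : ℝ) (u : ℕ → ℝ) (l : ℕ) :
    (bdStep a b)^[l] (c • u) = c • (bdStep a b)^[l] u := by
  rw [← Module.End.pow_apply, map_smul, Module.End.pow_apply]

theorem step_nonneg (H : IsBirthDeath a b) {u : ℕ → ℝ} (hu : 0 ≤ u) : 0 ≤ bdStep a b u := by
  intro n
  have h1 := mul_nonneg H.pos.le (hu (n + 1))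
  have h2 := mul_nonneg (H.nonneg n) (hu (n - 1))
  have h3 := mul_nonneg (sub_nonneg.2 (H.le_one n)) (hu n)
  simp only [Pi.zero_apply, bdStep_apply] at *
  linarith

theorem iterate_nonneg (H : IsBirthDeath a b) {u : ℕ → ℝ} (hu : 0 ≤ u) (l : ℕ) :
    0 ≤ (bdStep a b)^[l] u := by
  induction l with
  | zero => exact hu
  | succ l ih => rw [Function.iterate_succ_apply']; exact H.step_nonneg ih

theorem iterate_le (H : IsBirthDeath a b) {u v : ℕ → ℝ} (huv : u ≤ v) (l : ℕ) :
    (bdStep a b)^[l] u ≤ (bdStep a b)^[l] v := by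
  have := H.iterate_nonneg (sub_nonneg.2 huv) l
  rw [iterate_map_sub] at this
  exact sub_nonneg.1 this

theorem const_le_iterate (H : IsBirthDeath a b) {u : ℕ → ℝ} {c : ℝ} (hu : ∀ n, c ≤ u n) (l n : ℕ) :
    c ≤ (bdStep a b)^[l] u n := by
  have := H.iterate_le (u := fun _ => c) (v := u) hu l n
  rwa [iterate_const] at this

theorem iterate_le_const (H : IsBirthDeath a b) {u : ℕ → ℝ} {c : ℝ} (hu : ∀ n, u n ≤ c) (l n : ℕ) :
    (bdStep a b)^[l] u n ≤ c := by
  have := H.iterate_le (u := u) (v := fun _ => c) hu l n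
  rwa [iterate_const] at this

/-- An increment of the image is a combination of three neighbouring increments of `u` with weights
`a`, `1 - a - b (n + 1)` and `b n`, all nonnegative. -/
theorem step_monotone (H : IsBirthDeath a b) {u : ℕ → ℝ} (hu : Monotone u) :
    Monotone (bdStep a b u) := by
  refine monotone_nat_of_le_succ fun n => ?_
  have h1 := mul_nonneg H.pos.le (sub_nonneg.2 (hu (Nat.le_succ (n + 1))))
  have h2 := mul_nonneg (H.nonneg n) (sub_nonneg.2 (hu (Nat.sub_le n 1)))
  have h3 := mul_nonneg (sub_nonneg.2 (H.le_one (n + 1))) (sub_nonneg.2 (hu (Nat.le_succ n)))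
  simp only [bdStep_apply, Nat.add_sub_cancel, Nat.succ_eq_add_one] at *
  linarith

theorem iterate_monotone (H : IsBirthDeath a b) {u : ℕ → ℝ} (hu : Monotone u) (l : ℕ) :
    Monotone ((bdStep a b)^[l] u) := by
  induction l with
  | zero => exact hu
  | succ l ih => rw [Function.iterate_succ_apply']; exact H.step_monotone ih

/-- From a state that is never left downwards, expectations of monotone functions grow. -/
theorem monotone_iterate (H : IsBirthDeath a b) {u : ℕ → ℝ} (hu : Monotone u) {j : ℕ}
    (hj : b j = 0) : Monotone fun l => (bdStep a b)^[l] u j := by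
  refine monotone_nat_of_le_succ fun l => ?_
  rw [Function.iterate_succ_apply', bdStep_apply, hj]
  have := mul_nonneg H.pos.le (sub_nonneg.2 (H.iterate_monotone hu l (Nat.le_succ j)))
  simp only [Nat.succ_eq_add_one] at this
  linarith

/-- The chain moves from `k` to `k + 1` with probability `a > 0`, so bounds on the means spread
upwards from state `0`. -/
theorem iterate_succ_state_le (H : IsBirthDeath a b) {u : ℕ → ℝ} (hu : 0 ≤ u) (l k : ℕ) :
    a * (bdStep a b)^[l] u (k + 1) ≤ (bdStep a b)^[l + 1] u k := by
  have hv := H.iterate_nonneg hu l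
  rw [Function.iterate_succ_apply', bdStep_apply]
  have h2 := mul_nonneg (H.nonneg k) (hv (k - 1))
  have h3 := mul_nonneg (sub_nonneg.2 (H.le_one k)) (hv k)
  linarith

theorem exists_iterate_le (H : IsBirthDeath a b) {u : ℕ → ℝ} (hu : 0 ≤ u) {c : ℝ}
    (hc : ∀ l, (bdStep a b)^[l] u 0 ≤ c) (k : ℕ) : ∃ c', ∀ l, (bdStep a b)^[l] u k ≤ c' := by
  induction k with
  | zero => exact ⟨c, hc⟩
  | succ k ih =>
    obtain ⟨c', h⟩ := ih
    refine ⟨c' / a, fun l => ?_⟩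
    rw [le_div_iff₀ H.pos, mul_comm]
    exact (H.iterate_succ_state_le hu l k).trans (h _)

/-- Summed over time, the one-step equation at `k` telescopes and links the accumulated increments
on the two sides of `k`. -/
theorem sum_iterate_step (u : ℕ → ℝ) (n k : ℕ) :
    a * ∑ l ∈ Finset.range n, ((bdStep a b)^[l] u (k + 1) - (bdStep a b)^[l] u k) =
      (bdStep a b)^[n] u k - u k +
        b k * ∑ l ∈ Finset.range n, ((bdStep a b)^[l] u k - (bdStep a b)^[l] u (k - 1)) := by
  have h : (bdStep a b)^[n] u k - u k = ∑ l ∈ Finset.range n,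
      ((bdStep a b)^[l + 1] u k - (bdStep a b)^[l] u k) :=
    (Finset.sum_range_sub (fun l => (bdStep a b)^[l] u k) n).symm
  rw [h, Finset.mul_sum, Finset.mul_sum, ← Finset.sum_add_distrib]
  refine Finset.sum_congr rfl fun l _ => ?_
  rw [Function.iterate_succ_apply', bdStep_apply]
  ring

theorem exists_sum_le (H : IsBirthDeath a b) {u : ℕ → ℝ} (hu : 0 ≤ u) {c : ℝ}
    (hc : ∀ l, (bdStep a b)^[l] u 0 ≤ c) (k : ℕ) :
    ∃ c', ∀ n, ∑ l ∈ Finset.range n,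
      ((bdStep a b)^[l] u (k + 1) - (bdStep a b)^[l] u k) ≤ c' := by
  induction k with
  | zero =>
    refine ⟨(c - u 0) / a, fun n => ?_⟩
    rw [le_div_iff₀ H.pos, mul_comm, sum_iterate_step, H.zero]
    linarith [hc n]
  | succ k ih =>
    obtain ⟨c₁, h₁⟩ := ih
    obtain ⟨c₂, h₂⟩ := H.exists_iterate_le hu hc (k + 1)
    refine ⟨(c₂ - u (k + 1) + b (k + 1) * c₁) / a, fun n => ?_⟩
    rw [le_div_iff₀ H.pos, mul_comm, sum_iterate_step, Nat.add_sub_cancel]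
    have := mul_le_mul_of_nonneg_left (h₁ n) (H.nonneg (k + 1))
    linarith [h₂ n]

/-- Expectations of a nonnegative monotone function that stay bounded from the state `0` converge,
to a limit that does not depend on the initial state. -/
theorem exists_tendsto (H : IsBirthDeath a b) {u : ℕ → ℝ} (hu : 0 ≤ u) (hmono : Monotone u) {c : ℝ}
    (hc : ∀ l, (bdStep a b)^[l] u 0 ≤ c) :
    ∃ C, ∀ k, Tendsto (fun l => (bdStep a b)^[l] u k) atTop (𝓝 C) := by
  -- From the lowest state the means increase in time, so they converge to their supremum.
  refine ⟨⨆ l, (bdStep a b)^[l] u 0, fun k => ?_⟩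
  induction k with
  | zero =>
    exact tendsto_atTop_ciSup (H.monotone_iterate hmono H.zero) ⟨c, by rintro _ ⟨l, rfl⟩; exact hc l⟩
  | succ k ih =>
    -- The means at `k + 1` and `k` differ by nonnegative terms with bounded sums over time. The
    -- difference tends to `0`, with no appeal to aperiodicity or irreducibility.
    obtain ⟨c', h'⟩ := H.exists_sum_le hu hc k
    have h0 := (summable_of_sum_range_le (fun l => sub_nonneg.2
      (H.iterate_monotone hmono l (Nat.le_succ k))) h').tendsto_atTop_zero
    simpa using h0.add ih

/-- Drift inequality: `U g ≤ g - e` bounds the accumulated expectations of `e`. -/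
theorem iterate_add_sum_le (H : IsBirthDeath a b) {g e : ℕ → ℝ} (h : bdStep a b g ≤ g - e)
    (n k : ℕ) : (bdStep a b)^[n] g k + ∑ l ∈ Finset.range n, (bdStep a b)^[l] e k ≤ g k := by
  induction n with
  | zero => simp
  | succ n ih =>
    have := H.iterate_le h n k
    rw [iterate_map_sub, ← Function.iterate_succ_apply] at this
    rw [Finset.sum_range_succ]
    simp only [Pi.sub_apply] at this
    linarith

theorem hasSum_iterate (u : ℕ → ℝ) (l i : ℕ) :
    HasSum (fun j => (bdStep a b)^[l] (Pi.single j 1) i * u j) ((bdStep a b)^[l] u i) := by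
  induction l generalizing i with
  | zero =>
    have := hasSum_single (f := fun j => (Pi.single j (1 : ℝ) : ℕ → ℝ) i * u j) i
      (fun j hj => by simp [hj.symm])
    simpa using this
  | succ l ih =>
    simp only [Function.iterate_succ_apply', bdStep_apply]
    convert ((ih i).add (((ih (i + 1)).sub (ih i)).mul_left a)).add
      (((ih (i - 1)).sub (ih i)).mul_left (b i)) using 1
    ext j
    ring

theorem tendsto_iterate_of_tendsto {v : ℕ → ℕ → ℝ} {u : ℕ → ℝ}
    (h : ∀ i, Tendsto (fun N => v N i) atTop (𝓝 (u i))) (l i : ℕ) :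
    Tendsto (fun N => (bdStep a b)^[l] (v N) i) atTop (𝓝 ((bdStep a b)^[l] u i)) := by
  induction l generalizing i with
  | zero => exact h i
  | succ l ih =>
    simp only [Function.iterate_succ_apply', bdStep_apply]
    exact ((ih i).add (((ih (i + 1)).sub (ih i)).const_mul a)).add
      (((ih (i - 1)).sub (ih i)).const_mul (b i))

/-! ### Limiting law, detailed balance and positivity. -/

/-- `p` is the limiting distribution of the chain, from every initial state. -/
def _root_.IsLimitLaw (a : ℝ) (b p : ℕ → ℝ) : Prop :=
  ∀ k i, Tendsto (fun l => (bdStep a b)^[l] (Pi.single k 1) i) atTop (𝓝 (p k))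

theorem indicator_sub_indicator (k : ℕ) :
    (Pi.single k 1 : ℕ → ℝ) = (Set.Ici k).indicator 1 - (Set.Ici (k + 1)).indicator 1 := by
  ext n
  rcases lt_trichotomy n k with h | h | h
  · simp [h.ne, Set.indicator, h.not_ge, show ¬ k + 1 ≤ n by omega]
  · simp [h, Set.indicator]
  · simp [h.ne', Set.indicator, h.le, show k + 1 ≤ n by omega]

theorem indicator_Ici_monotone (k : ℕ) : Monotone ((Set.Ici k).indicator (1 : ℕ → ℝ)) := by
  intro m n hmn
  by_cases h : k ≤ m
  · simp [Set.indicator, h, h.trans hmn]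
  · simp only [Set.indicator, Set.mem_Ici, h, if_false]
    split_ifs <;> simp

theorem exists_tendsto_indicator (H : IsBirthDeath a b) (k : ℕ) :
    ∃ C, ∀ i, Tendsto (fun l => (bdStep a b)^[l] ((Set.Ici k).indicator 1) i) atTop (𝓝 C) := by
  refine H.exists_tendsto (c := 1) (fun n => Set.indicator_nonneg (by simp) n)
    (indicator_Ici_monotone k) (fun l => H.iterate_le_const (fun n => ?_) l 0)
  exact Set.indicator_le_self' (by simp) n

/-- Point masses are differences of monotone tail indicators, whose means converge. All mass may
still escape to infinity, so `p = 0` is possible here. -/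
theorem exists_isLimitLaw (H : IsBirthDeath a b) : ∃ p, IsLimitLaw a b p := by
  choose C hC using H.exists_tendsto_indicator
  refine ⟨fun k => C k - C (k + 1), fun k i => ?_⟩
  rw [indicator_sub_indicator]
  simp only [iterate_map_sub]
  exact (hC k i).sub (hC (k + 1) i)

theorem law_nonneg (H : IsBirthDeath a b) {p : ℕ → ℝ} (hp : IsLimitLaw a b p) (k : ℕ) : 0 ≤ p k :=
  ge_of_tendsto' (hp k 0) fun l => H.iterate_nonneg (Pi.single_nonneg.2 zero_le_one) l 0

/-- Detailed balance. -/
theorem law_balance (H : IsBirthDeath a b) {p : ℕ → ℝ} (hp : IsLimitLaw a b p) (k : ℕ) :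
    a * p k = b (k + 1) * p (k + 1) := by
  obtain ⟨C, hC⟩ := H.exists_tendsto_indicator (k + 1)
  have h1 := ((tendsto_add_atTop_iff_nat 1).2 (hC 0)).sub (hC 0)
  have h2 := ((hp k 0).const_mul a).sub ((hp (k + 1) 0).const_mul (b (k + 1)))
  -- The tail probability changes only through the edge between `k` and `k + 1`; in the limit the
  -- two flows cancel.
  have key : bdStep a b ((Set.Ici (k + 1)).indicator 1) - (Set.Ici (k + 1)).indicator 1
      = a • Pi.single k 1 - b (k + 1) • Pi.single (k + 1) 1 := by
    ext n
    simp only [bdStep_apply, Set.indicator, Set.mem_Ici, Pi.sub_apply, Pi.smul_apply,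
      Pi.single_apply, smul_eq_mul, Pi.one_apply]
    rcases lt_trichotomy n k with h | h | h
    · simp [show ¬ k + 1 ≤ n by omega, show ¬ k ≤ n by omega, show ¬ k + 1 ≤ n - 1 by omega,
        show n ≠ k by omega, show n ≠ k + 1 by omega]
    · subst h
      simp [show ¬ n + 1 ≤ n - 1 by omega]
    · rcases eq_or_ne n (k + 1) with h' | h'
      · subst h'; simp
      · simp [show k + 1 ≤ n by omega, show k + 1 ≤ n - 1 by omega, show k ≤ n by omega, h', h.ne']
  have h3 : ∀ l, (bdStep a b)^[l + 1] ((Set.Ici (k + 1)).indicator 1) 0 -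
      (bdStep a b)^[l] ((Set.Ici (k + 1)).indicator 1) 0 =
      a * (bdStep a b)^[l] (Pi.single k 1) 0 -
        b (k + 1) * (bdStep a b)^[l] (Pi.single (k + 1) 1) 0 := by
    intro l
    have := congrFun (congrArg ((bdStep a b)^[l]) key) 0
    simpa only [iterate_map_sub, iterate_smul, Pi.sub_apply, Pi.smul_apply, smul_eq_mul,
      ← Function.iterate_succ_apply] using this
  have h4 := tendsto_nhds_unique (h1.congr h3) h2
  linarith

theorem iterate_sum_single (M l i : ℕ) (x : ℕ → ℝ) :
    (bdStep a b)^[l] (∑ k ∈ Finset.range M, x k • Pi.single k 1) i =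
      ∑ k ∈ Finset.range M, x k * (bdStep a b)^[l] (Pi.single k 1) i := by
  rw [← Module.End.pow_apply, map_sum, Finset.sum_apply]
  refine Finset.sum_congr rfl fun k _ => ?_
  rw [map_smul, Module.End.pow_apply]
  rfl

theorem sum_single_apply (M n : ℕ) (x : ℕ → ℝ) :
    (∑ k ∈ Finset.range M, x k • (Pi.single k 1 : ℕ → ℝ)) n = if n < M then x n else 0 := by
  simp [Finset.sum_apply, Pi.single_apply]

/-- Tightness: bounded means of a function tending to infinity prevent all the mass from escaping.
-/
theorem exists_law_pos (H : IsBirthDeath a b) {p : ℕ → ℝ} (hp : IsLimitLaw a b p) {u : ℕ → ℝ}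
    (hu : 0 ≤ u) (hlim : Tendsto u atTop atTop) {c : ℝ}
    (hc : ∀ l, (bdStep a b)^[l] u 0 ≤ c) : ∃ k, 0 < p k := by
  by_contra! hcon
  have hp0 : ∀ k, p k = 0 := fun k => le_antisymm (hcon k) (H.law_nonneg hp k)
  have hc0 : 0 ≤ c := (hu 0).trans (hc 0)
  obtain ⟨N, hN⟩ := (hlim.eventually_ge_atTop (2 * c + 1)).exists_forall_of_atTop
  -- If `p` vanished, the finite sum would disappear in the limit, leaving `2 * c + 1 ≤ c` with `c ≥
  -- 0`.
  have hle : (fun _ : ℕ => 2 * c + 1) ≤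
      (∑ k ∈ Finset.range N, (2 * c + 1) • (Pi.single k 1 : ℕ → ℝ)) + u := by
    intro n
    rw [Pi.add_apply, sum_single_apply N n fun _ => 2 * c + 1]
    split_ifs with h
    · linarith [show 0 ≤ u n from hu n]
    · linarith [hN n (not_lt.1 h)]
  have h1 : ∀ l, 2 * c + 1 ≤
      ∑ k ∈ Finset.range N, (2 * c + 1) * (bdStep a b)^[l] (Pi.single k 1) 0 + c := by
    intro l
    have := H.iterate_le hle l 0
    rw [iterate_const, iterate_map_add, Pi.add_apply,
      iterate_sum_single N l 0 fun _ => 2 * c + 1] at this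
    linarith [hc l]
  have h2 := ge_of_tendsto' ((tendsto_finsetSum (Finset.range N)
    fun k _ => (hp k 0).const_mul (2 * c + 1)).add_const c) h1
  simp only [hp0, mul_zero, Finset.sum_const_zero] at h2
  linarith

/-- The limiting distribution charges every state above which all down-probabilities are
positive. -/
theorem law_pos (H : IsBirthDeath a b) {p : ℕ → ℝ} (hp : IsLimitLaw a b p) (hex : ∃ k, 0 < p k)
    {m : ℕ} (hm : ∀ j, m < j → 0 < b j) {k : ℕ} (hk : m ≤ k) : 0 < p k := by
  have hup : ∀ k, m ≤ k → 0 < p m → 0 < p k := by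
    intro k hk hpm
    induction k, hk using Nat.le_induction with
    | base => exact hpm
    | succ k hk ih =>
      have h := H.law_balance hp k
      exact pos_of_mul_pos_right (h ▸ mul_pos H.pos ih) (H.nonneg (k + 1))
  refine hup k hk ?_
  by_contra hcon
  have h0 : p m = 0 := le_antisymm (not_lt.1 hcon) (H.law_nonneg hp m)
  obtain ⟨j, hj⟩ := hex
  -- Balance carries a zero of `p` upwards because `b` is positive above `m`, and downwards because
  -- `a` is positive.
  have hz : ∀ j, p (m + j) = 0 := by
    intro j
    induction j with
    | zero => exact h0
    | succ j ih =>
      have h := H.law_balance hp (m + j)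
      rw [ih, mul_zero] at h
      exact (mul_eq_zero.1 h.symm).resolve_left (hm _ (by omega)).ne'
  have hz' : ∀ j ≤ m, p (m - j) = 0 := by
    intro j hj
    induction j with
    | zero => exact h0
    | succ j ih =>
      have h := H.law_balance hp (m - (j + 1))
      rw [show m - (j + 1) + 1 = m - j by omega, ih (by omega), mul_zero] at h
      exact (mul_eq_zero.1 h).resolve_left H.pos.ne'
  rcases le_total m j with h | h
  · have := hz (j - m)
    rw [show m + (j - m) = j by omega] at this
    exact hj.ne' this
  · have := hz' (m - j) (by omega)
    rw [show m - (m - j) = j by omega] at this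
    exact hj.ne' this

/-- Multiplied by `p k` and rewritten by detailed balance, the Poisson equation telescopes into a
flux through the edge from `M` to `M + 1`. -/
theorem law_sum_eq (H : IsBirthDeath a b) {p : ℕ → ℝ} (hp : IsLimitLaw a b p) {g e : ℕ → ℝ}
    (h : bdStep a b g = g - e) (M : ℕ) :
    a * p M * (g (M + 1) - g M) = -∑ k ∈ Finset.range (M + 1), e k * p k := by
  have hk : ∀ k, e k = -(a * (g (k + 1) - g k)) + b k * (g k - g (k - 1)) := by
    intro k
    have := congrFun h k
    rw [bdStep_apply, Pi.sub_apply] at this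
    linarith
  induction M with
  | zero => simp [hk 0]; ring
  | succ M ih =>
    rw [Finset.sum_range_succ, neg_add, ← ih, hk (M + 1), Nat.add_sub_cancel, H.law_balance hp M]
    ring

/-! ### Poisson equation and drift inequalities. -/

/-- If `e` is eventually nonnegative and its expectations tend to `0`, then solutions of the
Poisson equation `U g = g - e` are eventually nondecreasing. -/
theorem eventually_le_succ (H : IsBirthDeath a b) {p : ℕ → ℝ} (hp : IsLimitLaw a b p) {m : ℕ}
    (hpos : ∀ k, m ≤ k → 0 < p k) {g e : ℕ → ℝ} (h : bdStep a b g = g - e)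
    (he : Tendsto (fun l => (bdStep a b)^[l] e 0) atTop (𝓝 0)) {N : ℕ} (hN : ∀ k, N ≤ k → 0 ≤ e k) :
    ∃ N', ∀ k, N' ≤ k → g k ≤ g (k + 1) := by
  refine ⟨max m N, fun M hM => ?_⟩
  -- Past `N` the discarded values of `e` are nonnegative. The limit of means of the truncation is
  -- therefore at most `0`, as in Fatou's lemma.
  have hle : ∑ k ∈ Finset.range (M + 1), e k • (Pi.single k 1 : ℕ → ℝ) ≤ e := by
    intro n
    rw [sum_single_apply]
    split_ifs with hn
    · exact le_rfl
    · exact hN n (by have := le_max_right m N; omega)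
  have h1 : ∑ k ∈ Finset.range (M + 1), e k * p k ≤ 0 := by
    refine le_of_tendsto_of_tendsto' (tendsto_finsetSum _ fun k _ => (hp k 0).const_mul (e k)) he
      fun l => ?_
    rw [← iterate_sum_single]
    exact H.iterate_le hle l 0
  have h2 := H.law_sum_eq hp h M
  have h3 : 0 < a * p M := mul_pos H.pos (hpos M ((le_max_left _ _).trans hM))
  have h4 : 0 ≤ a * p M * (g (M + 1) - g M) := by rw [h2]; linarith
  linarith [nonneg_of_mul_nonneg_right h4 h3]

theorem _root_.exists_lower_bound_of_eventually_le_succ {g : ℕ → ℝ} {N : ℕ}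
    (h : ∀ k, N ≤ k → g k ≤ g (k + 1)) : ∃ c, ∀ k, c ≤ g k := by
  obtain ⟨c, hc⟩ := ((Finset.range (N + 1)).image g).bddBelow
  have hc' : ∀ k ≤ N, c ≤ g k := fun k hk =>
    hc (Finset.mem_coe.2 (Finset.mem_image_of_mem g (Finset.mem_range.2 (by omega))))
  refine ⟨c, fun k => ?_⟩
  rcases le_total k N with hk | hk
  · exact hc' k hk
  · induction k, hk using Nat.le_induction with
    | base => exact hc' N le_rfl
    | succ k hk ih => exact ih.trans (h k hk)

/-- A drift towards small values of the monotone function `u` bounds its expectations. -/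
theorem exists_iterate_le_of_drift (H : IsBirthDeath a b) {u g : ℕ → ℝ} (hu : 0 ≤ u)
    (hmono : Monotone u) {c c' : ℝ} (hg : ∀ k, c ≤ g k)
    (h : bdStep a b g ≤ g - (u - fun _ => c')) : ∃ C, ∀ l, (bdStep a b)^[l] u 0 ≤ C := by
  have hA := H.monotone_iterate hmono H.zero
  refine ⟨max (2 * |c'| + (g 0 - c)) (u 0), fun l => ?_⟩
  rcases Nat.eq_zero_or_pos l with rfl | hl
  · exact le_max_right _ _
  refine le_max_of_le_left ?_
  have h1 := H.iterate_add_sum_le h (2 * l) 0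
  have h2 := H.const_le_iterate hg (2 * l) 0
  simp only [iterate_map_sub, iterate_const, Pi.sub_apply, Finset.sum_sub_distrib,
    Finset.sum_const, Finset.card_range, nsmul_eq_mul] at h1
  -- The means from `0` grow in time, so each of the `l` terms of the second half of the window `[0,
  -- 2 * l)` dominates the mean at time `l`. This turns a bound on time averages into a bound at
  -- each time.
  have h3 : l * (bdStep a b)^[l] u 0 ≤ ∑ i ∈ Finset.range (2 * l), (bdStep a b)^[i] u 0 := by
    rw [two_mul, Finset.sum_range_add]
    have h4 : 0 ≤ ∑ i ∈ Finset.range l, (bdStep a b)^[i] u 0 :=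
      Finset.sum_nonneg fun i _ => H.iterate_nonneg hu i 0
    have h5 : l * (bdStep a b)^[l] u 0 ≤ ∑ i ∈ Finset.range l, (bdStep a b)^[l + i] u 0 := by
      have := Finset.card_nsmul_le_sum (Finset.range l) (fun i => (bdStep a b)^[l + i] u 0)
        ((bdStep a b)^[l] u 0) (fun i _ => hA (Nat.le_add_right l i))
      simpa using this
    linarith
  have hl1 : (1 : ℝ) ≤ l := by exact_mod_cast hl
  have h6 : (g 0 - c) ≤ l * (g 0 - c) := le_mul_of_one_le_left (by linarith [hg 0]) hl1
  have h7 : (2 * l : ℝ) * c' ≤ l * (2 * |c'|) := by nlinarith [le_abs_self c']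
  push_cast at h1
  have h8 : (l : ℝ) * (bdStep a b)^[l] u 0 ≤ l * (2 * |c'| + (g 0 - c)) := by linarith
  exact le_of_mul_le_mul_left h8 (by linarith)

/-- Drift inequality with a gain `ε` in state `m`: the limit of the expectations of `e` is at most
`-ε` times the limiting probability of `m`. -/
theorem limit_le_of_drift (H : IsBirthDeath a b) {p : ℕ → ℝ} (hp : IsLimitLaw a b p)
    {g e : ℕ → ℝ} {c C ε : ℝ} {m : ℕ} (hg : ∀ k, c ≤ g k)
    (h : bdStep a b g ≤ g - (e + ε • Pi.single m 1))
    (he : Tendsto (fun l => (bdStep a b)^[l] e 0) atTop (𝓝 C)) : C ≤ -(ε * p m) := by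
  have h1 : Tendsto (fun l => (bdStep a b)^[l] (e + ε • Pi.single m 1) 0) atTop
      (𝓝 (C + ε * p m)) := by
    simp only [iterate_map_add, iterate_smul, Pi.add_apply, Pi.smul_apply, smul_eq_mul]
    exact he.add ((hp m 0).const_mul ε)
  have h2 := h1.cesaro
  have h3 : Tendsto (fun n : ℕ => (n : ℝ)⁻¹ * (g 0 - c)) atTop (𝓝 0) := by
    simpa using (tendsto_inv_atTop_nhds_zero_nat (𝕜 := ℝ)).mul_const (g 0 - c)
  -- The lower bound of `g` leaves `g 0 - c` as a bound for the accumulated means, and dividing by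
  -- `n` removes it.
  have h4 := le_of_tendsto_of_tendsto' h2 h3 fun n => by
    refine mul_le_mul_of_nonneg_left ?_ (by positivity)
    linarith [H.iterate_add_sum_le h n 0, H.const_le_iterate hg n 0]
  linarith

end IsBirthDeath

/-! ### Poisson mixtures of sequences. -/

/-- The mean of the sequence `s` under the Poisson distribution with mean `x`. -/
def poissonMean (s : ℕ → ℝ) (x : ℝ) : ℝ :=
  ∑' l : ℕ, Real.exp (-x) * x ^ l / (l.factorial : ℝ) * s l

namespace poissonMean

theorem hasSum_weight (x : ℝ) :
    HasSum (fun l : ℕ => Real.exp (-x) * x ^ l / (l.factorial : ℝ)) 1 := by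
  have h := (NormedSpace.expSeries_div_hasSum_exp (𝔸 := ℝ) x).mul_left (Real.exp (-x))
  rw [← Real.exp_eq_exp_ℝ, ← Real.exp_add, neg_add_cancel, Real.exp_zero] at h
  simpa only [mul_div_assoc] using h

theorem weight_nonneg {x : ℝ} (hx : 0 ≤ x) (l : ℕ) :
    0 ≤ Real.exp (-x) * x ^ l / (l.factorial : ℝ) := by positivity

theorem summable {s : ℕ → ℝ} {c : ℝ} (hs : ∀ l, |s l| ≤ c) (x : ℝ) :
    Summable fun l : ℕ => Real.exp (-x) * x ^ l / (l.factorial : ℝ) * s l := by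
  refine Summable.of_norm_bounded ((hasSum_weight x).summable.norm.mul_right c) fun l => ?_
  rw [norm_mul]
  exact mul_le_mul_of_nonneg_left (hs l) (norm_nonneg _)

theorem abs_le {s : ℕ → ℝ} {c : ℝ} (hs : ∀ l, |s l| ≤ c) {x : ℝ} (hx : 0 ≤ x) :
    |poissonMean s x| ≤ c := by
  have h1 := (hasSum_weight x).mul_right c
  rw [one_mul] at h1
  rw [← Real.norm_eq_abs, poissonMean]
  refine tsum_of_norm_bounded h1 fun l => ?_
  rw [norm_mul, Real.norm_of_nonneg (weight_nonneg hx l)]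
  exact mul_le_mul_of_nonneg_left (hs l) (weight_nonneg hx l)

theorem sub {s s' : ℕ → ℝ} {c c' : ℝ} (hs : ∀ l, |s l| ≤ c) (hs' : ∀ l, |s' l| ≤ c') (x : ℝ) :
    poissonMean (fun l => s l - s' l) x = poissonMean s x - poissonMean s' x := by
  simp only [poissonMean, mul_sub]
  exact (summable hs x).tsum_sub (summable hs' x)

theorem const_mul (k : ℝ) (s : ℕ → ℝ) (x : ℝ) :
    poissonMean (fun l => k * s l) x = k * poissonMean s x := by
  simp only [poissonMean, mul_left_comm _ k]
  exact tsum_mul_left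

theorem const (k x : ℝ) : poissonMean (fun _ => k) x = k := by
  have h1 := (hasSum_weight x).mul_right k
  rw [one_mul] at h1
  exact h1.tsum_eq

theorem zero (s : ℕ → ℝ) : poissonMean s 0 = s 0 := by
  rw [poissonMean, tsum_eq_single 0 fun l hl => by simp [hl]]
  simp

theorem tendsto_weight (l : ℕ) :
    Tendsto (fun x : ℝ => Real.exp (-x) * x ^ l / (l.factorial : ℝ)) atTop (𝓝 0) := by
  have h := (Real.tendsto_pow_mul_exp_neg_atTop_nhds_zero l).div_const (l.factorial : ℝ)
  rw [zero_div] at h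
  exact h.congr fun x => by ring

/-- As the Poisson parameter grows, any fixed finite set of indices loses its weight, so only the
tail of `s` counts. -/
theorem tendsto {s : ℕ → ℝ} {c C : ℝ} (hs : ∀ l, |s l| ≤ c) (hC : Tendsto s atTop (𝓝 C)) :
    Tendsto (poissonMean s) atTop (𝓝 C) := by
  suffices h : Tendsto (fun x => poissonMean (fun l => s l - C) x) atTop (𝓝 0) by
    have h' := h.add_const C
    rw [zero_add] at h'
    refine h'.congr fun x => ?_
    rw [sub hs (fun _ => le_rfl) x, const]
    ring
  have hb : ∀ l, |s l - C| ≤ c + |C| := fun l => (abs_sub _ _).trans (by linarith [hs l])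
  rw [Metric.tendsto_atTop]
  intro ε hε
  obtain ⟨L, hL⟩ := Metric.tendsto_atTop.1 hC (ε / 2) (half_pos hε)
  have h1 : Tendsto (fun x : ℝ => ∑ l ∈ Finset.range L,
      Real.exp (-x) * x ^ l / (l.factorial : ℝ) * (c + |C|)) atTop (𝓝 0) := by
    simpa using tendsto_finsetSum (Finset.range L) fun l _ =>
      (tendsto_weight l).mul_const (c + |C|)
  obtain ⟨x₀, hx₀⟩ := ((h1.eventually (gt_mem_nhds (half_pos hε))).and
    (eventually_ge_atTop 0)).exists_forall_of_atTop
  refine ⟨x₀, fun x hx => ?_⟩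
  obtain ⟨h2, hx0⟩ := hx₀ x hx
  rw [dist_zero_right]
  have h3 : HasSum (fun l => Real.exp (-x) * x ^ l / (l.factorial : ℝ) * (ε / 2) +
      if l ∈ Finset.range L then Real.exp (-x) * x ^ l / (l.factorial : ℝ) * (c + |C|) else 0)
      (1 * (ε / 2) + ∑ l ∈ Finset.range L,
        Real.exp (-x) * x ^ l / (l.factorial : ℝ) * (c + |C|)) := by
    refine ((hasSum_weight x).mul_right (ε / 2)).add ?_
    have := hasSum_sum_of_ne_finset_zero (L := SummationFilter.unconditional ℕ) (s := Finset.range L) (f := fun l =>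
      if l ∈ Finset.range L then Real.exp (-x) * x ^ l / (l.factorial : ℝ) * (c + |C|) else 0)
      (fun l hl => if_neg hl)
    rwa [Finset.sum_congr rfl fun l hl => if_pos hl] at this
  refine (tsum_of_norm_bounded h3 fun l => ?_).trans_lt (by linarith)
  rw [norm_mul, Real.norm_of_nonneg (weight_nonneg hx0 l)]
  have hw := weight_nonneg hx0 l
  split_ifs with hl
  · have := mul_le_mul_of_nonneg_left (hb l) hw
    have h5 := mul_nonneg hw (half_pos hε).le
    rw [Real.norm_eq_abs]
    linarith
  · rw [add_zero]
    refine mul_le_mul_of_nonneg_left ?_ hw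
    have := hL l (by simpa using hl)
    rw [Real.dist_eq] at this
    exact this.le

/-- Differentiating the power series shifts the index by one, and the factor `exp (-x)` subtracts
the unshifted series. For iterates of the chain this is the backward equation. -/
theorem hasDerivAt {s : ℕ → ℝ} {c : ℝ} (hs : ∀ l, |s l| ≤ c) (x : ℝ) :
    HasDerivAt (poissonMean s) (poissonMean (fun l => s (l + 1) - s l) x) x := by
  have hc : 0 ≤ c := (abs_nonneg _).trans (hs 0)
  have hF : ∀ (s : ℕ → ℝ), poissonMean s =
      fun y => Real.exp (-y) * ∑' l : ℕ, s l * (y ^ l / (l.factorial : ℝ)) := by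
    intro s
    ext y
    rw [poissonMean, ← tsum_mul_left]
    exact tsum_congr fun l => by ring
  have hsum : ∀ R : ℝ, Summable fun n : ℕ => R ^ n / (n.factorial : ℝ) :=
    fun R => Real.summable_pow_div_factorial R
  have hshift : ∀ (n : ℕ) (y : ℝ), ((n + 1 : ℕ) : ℝ) * y ^ (n + 1 - 1) / ((n + 1).factorial : ℝ) =
      y ^ n / (n.factorial : ℝ) := by
    intro n y
    rw [Nat.factorial_succ, Nat.cast_mul, Nat.add_sub_cancel]
    exact mul_div_mul_left _ _ (by positivity)
  have hD : HasDerivAt (fun y => ∑' l : ℕ, s l * (y ^ l / (l.factorial : ℝ)))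
      (∑' l : ℕ, s l * (l * x ^ (l - 1) / (l.factorial : ℝ))) x := by
    refine hasDerivAt_tsum_of_isPreconnected (t := Metric.ball 0 (|x| + 1)) (y₀ := x)
      (u := fun n : ℕ => c * (n * (|x| + 1) ^ (n - 1) / (n.factorial : ℝ)))
      (g' := fun l y => s l * (l * y ^ (l - 1) / (l.factorial : ℝ)))
      ?_ Metric.isOpen_ball (convex_ball 0 _).isPreconnected ?_ ?_ (by simp) ?_ (by simp)
    · refine Summable.mul_left c ?_
      rw [← summable_nat_add_iff 1]
      simpa only [hshift] using hsum (|x| + 1)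
    · intro n y _
      exact ((hasDerivAt_pow n y).div_const _).const_mul (s n)
    · intro n y hy
      rw [mem_ball_zero_iff, Real.norm_eq_abs] at hy
      rw [norm_mul, norm_div, norm_mul, norm_pow, Real.norm_eq_abs, Real.norm_eq_abs y,
        Real.norm_natCast, Real.norm_natCast]
      gcongr
      exact hs n
    · refine Summable.of_norm_bounded ((hsum x).norm.mul_left c) fun l => ?_
      rw [norm_mul]
      exact mul_le_mul_of_nonneg_right (hs l) (norm_nonneg _)
  have hS : ∀ {s : ℕ → ℝ}, (∀ l, |s l| ≤ c) → Summable fun l => s l * (x ^ l / (l.factorial : ℝ)) :=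
    fun hs => Summable.of_norm_bounded ((hsum x).norm.mul_left c) fun l => by
      rw [norm_mul]
      exact mul_le_mul_of_nonneg_right (hs l) (norm_nonneg _)
  have hD' : (∑' l : ℕ, s l * (l * x ^ (l - 1) / (l.factorial : ℝ))) =
      ∑' l : ℕ, s (l + 1) * (x ^ l / (l.factorial : ℝ)) := by
    rw [Summable.tsum_eq_zero_add]
    · simp only [hshift]; simp
    · rw [← summable_nat_add_iff 1]
      simpa only [hshift] using hS (s := fun l => s (l + 1)) fun l => hs (l + 1)
  rw [hD'] at hD
  rw [hF s, hF]
  have hsub := (hS (s := fun l => s (l + 1)) fun l => hs (l + 1)).tsum_sub (hS hs)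
  refine HasDerivAt.congr_deriv
    (((Real.hasDerivAt_exp (-x)).comp x (hasDerivAt_neg x)).mul hD) ?_
  simp only [sub_mul, hsub, Function.comp]
  ring

theorem continuous {s : ℕ → ℝ} {c : ℝ} (hs : ∀ l, |s l| ≤ c) : Continuous (poissonMean s) :=
  continuous_iff_continuousAt.2 fun x => (hasDerivAt hs x).continuousAt

end poissonMean

/-- Time averages of a bounded continuous function converge to its limit. -/
theorem tendsto_time_average {φ : ℝ → ℝ} (hφ : Continuous φ) {c C : ℝ}
    (hb : ∀ t, 0 ≤ t → |φ t| ≤ c) (hC : Tendsto φ atTop (𝓝 C)) :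
    Tendsto (fun T : ℝ => (1 / T) * ∫ t in (0 : ℝ)..T, φ t) atTop (𝓝 C) := by
  -- Rescaling time to `[0, 1]` reduces the claim to dominated convergence.
  have h1 : Tendsto (fun T : ℝ => ∫ t in (0 : ℝ)..1, φ (t * T)) atTop
      (𝓝 (∫ _ in (0 : ℝ)..1, C)) := by
    refine intervalIntegral.tendsto_integral_filter_of_dominated_convergence (fun _ => c)
      (Eventually.of_forall fun T => ?_) ?_ intervalIntegrable_const ?_
    · exact (hφ.comp (continuous_mul_const T)).aestronglyMeasurable
    · filter_upwards [eventually_ge_atTop (0 : ℝ)] with T hT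
      refine Eventually.of_forall fun t ht => ?_
      rw [Set.uIoc_of_le zero_le_one] at ht
      exact hb _ (mul_nonneg ht.1.le hT)
    · refine Eventually.of_forall fun t ht => ?_
      rw [Set.uIoc_of_le zero_le_one] at ht
      exact hC.comp (tendsto_id.const_mul_atTop ht.1)
  rw [intervalIntegral.integral_const, sub_zero, one_smul] at h1
  refine h1.congr' ?_
  filter_upwards [eventually_gt_atTop (0 : ℝ)] with T hT
  rw [intervalIntegral.integral_comp_mul_right _ hT.ne', zero_mul, one_mul, smul_eq_mul, one_div]

/-! ### Uniformization of the queue, and means of the continuous-time process. -/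

namespace GroupServerQueue

variable (Q : GroupServerQueue)

/-- Up-probability of the uniformized chain. -/
def upProb : ℝ := Q.lam / Q.unifRate

/-- Down-probabilities of the uniformized chain of policy `d`. -/
def downProb (d : Q.Policy) (n : ℕ) : ℝ := Q.serviceRate (d n) / Q.unifRate

theorem unifStep_eq (d : Q.Policy) : Q.unifStep d = bdStep Q.upProb (Q.downProb d) := by
  ext u n
  rw [unifStep, generator, bdStep_apply, upProb, downProb]
  ring

variable {Q}

theorem unifRate_pos (hlam : 0 < Q.lam) (hmu : ∀ k, 0 < Q.mu k) : 0 < Q.unifRate :=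
  add_pos_of_pos_of_nonneg hlam
    (Finset.sum_nonneg fun k _ => mul_nonneg (Nat.cast_nonneg _) (hmu k).le)

theorem serviceRate_nonneg (hmu : ∀ k, 0 < Q.mu k) (m : Q.Action) : 0 ≤ Q.serviceRate m :=
  Finset.sum_nonneg fun k _ => mul_nonneg (Nat.cast_nonneg _) (hmu k).le

theorem eq_zero_of_mem_efficientActions_zero {m : Q.Action} (hm : m ∈ Q.efficientActions 0) :
    m = 0 := by
  ext k
  have := Finset.sum_eq_zero_iff.1 (Nat.le_zero.1 hm.2) k (Finset.mem_univ k)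
  simpa using this

theorem isBirthDeath (hlam : 0 < Q.lam) (hmu : ∀ k, 0 < Q.mu k) {d : Q.Policy}
    (hd : d ∈ Q.efficientPolicies) : IsBirthDeath Q.upProb (Q.downProb d) where
  pos := div_pos hlam (unifRate_pos hlam hmu)
  nonneg n := div_nonneg (serviceRate_nonneg hmu _) (unifRate_pos hlam hmu).le
  le_one n := by
    rw [upProb, downProb, ← add_div, div_le_one (unifRate_pos hlam hmu), unifRate, serviceRate]
    gcongr with k _
    · exact (hmu k).le
    · exact (hd n).1 k
  zero := by
    rw [downProb, eq_zero_of_mem_efficientActions_zero (hd 0)]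
    simp [serviceRate]

variable {Ω : Type*} [MeasurableSpace Ω]

section Law

variable {d : Q.Policy} {i : ℕ} {P : Measure Ω} {X : ℝ → Ω → ℕ}

theorem IsMarkovChain.measurable_apply (hX : Q.IsMarkovChain d i P X) (t : ℝ) : Measurable (X t) :=
  hX.measurable.comp measurable_prodMk_left

theorem IsMarkovChain.real_eq (hX : Q.IsMarkovChain d i P X) {t : ℝ} (ht : 0 ≤ t) (j : ℕ) :
    P.real {ω | X t ω = j} = poissonMean
      (fun l => (bdStep Q.upProb (Q.downProb d))^[l] (Pi.single j 1) i) (Q.unifRate * t) := by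
  have := hX.isProbabilityMeasure
  have h := hX.markov 0 t le_rfl ht j Set.univ MeasurableSet.univ
  rw [Set.univ_inter, Measure.restrict_univ, sub_zero] at h
  rw [h, integral_congr_ae (g := fun _ => Q.transProb d t i j)]
  · rw [integral_const, probReal_univ, one_smul, transProb, unifStep_eq]
    rfl
  · filter_upwards [hX.initial] with ω hω
    rw [hω]

/-- Tonelli exchanges the sum over states with the Poisson sum. Working in `ENNReal` makes this
legitimate for unbounded `u`, with integrability as a consequence. -/
theorem IsMarkovChain.lintegral_eq (hX : Q.IsMarkovChain d i P X)
    (H : IsBirthDeath Q.upProb (Q.downProb d)) (hΛ : 0 < Q.unifRate) {u : ℕ → ℝ} (hu : 0 ≤ u)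
    {c : ℝ} (hc : ∀ l, (bdStep Q.upProb (Q.downProb d))^[l] u i ≤ c) {t : ℝ} (ht : 0 ≤ t) :
    ∫⁻ ω, ENNReal.ofReal (u (X t ω)) ∂P = ENNReal.ofReal (poissonMean
      (fun l => (bdStep Q.upProb (Q.downProb d))^[l] u i) (Q.unifRate * t)) := by
  have := hX.isProbabilityMeasure
  have hx : 0 ≤ Q.unifRate * t := mul_nonneg hΛ.le ht
  have hw := poissonMean.weight_nonneg hx
  have hs : ∀ j l, 0 ≤ (bdStep Q.upProb (Q.downProb d))^[l] (Pi.single j 1) i := fun j l =>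
    H.iterate_nonneg (Pi.single_nonneg.2 zero_le_one) l i
  have hmap : ∫⁻ ω, ENNReal.ofReal (u (X t ω)) ∂P =
      ∑' j, ENNReal.ofReal (u j) * (P.map (X t)) {j} := by
    rw [← lintegral_countable', lintegral_map (measurable_of_countable _) (hX.measurable_apply t)]
  have hterm : ∀ j, (P.map (X t)) {j} = ∑' l : ℕ, ENNReal.ofReal
      (Real.exp (-(Q.unifRate * t)) * (Q.unifRate * t) ^ l / (l.factorial : ℝ)) *
        ENNReal.ofReal ((bdStep Q.upProb (Q.downProb d))^[l] (Pi.single j 1) i) := by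
    intro j
    rw [Measure.map_apply (hX.measurable_apply t) (measurableSet_singleton j)]
    have h1 : P (X t ⁻¹' {j}) = ENNReal.ofReal (P.real {ω | X t ω = j}) :=
      (ofReal_measureReal).symm
    rw [h1, hX.real_eq ht j, poissonMean, ENNReal.ofReal_tsum_of_nonneg
      (fun l => mul_nonneg (hw l) (hs j l)) (poissonMean.summable (c := 1) (fun l => ?_) _)]
    · exact tsum_congr fun l => ENNReal.ofReal_mul (hw l)
    · rw [abs_of_nonneg (hs j l)]
      refine H.iterate_le_const (fun n => ?_) l i
      rw [Pi.single_apply]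
      split_ifs <;> norm_num
  have hinner : ∀ l, ∑' j, ENNReal.ofReal ((bdStep Q.upProb (Q.downProb d))^[l] (Pi.single j 1) i) *
      ENNReal.ofReal (u j) = ENNReal.ofReal ((bdStep Q.upProb (Q.downProb d))^[l] u i) := by
    intro l
    have h := IsBirthDeath.hasSum_iterate (a := Q.upProb) (b := Q.downProb d) u l i
    rw [← h.tsum_eq, ENNReal.ofReal_tsum_of_nonneg (fun j => mul_nonneg (hs j l) (hu j)) h.summable]
    exact tsum_congr fun j => (ENNReal.ofReal_mul (hs j l)).symm
  have hu' := fun l => H.iterate_nonneg hu l i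
  rw [hmap, poissonMean, ENNReal.ofReal_tsum_of_nonneg (fun l => mul_nonneg (hw l) (hu' l))
    (poissonMean.summable (c := c) (fun l => by rw [abs_of_nonneg (hu' l)]; exact hc l) _)]
  simp only [hterm, ← ENNReal.tsum_mul_left]
  rw [ENNReal.tsum_comm]
  refine tsum_congr fun l => ?_
  rw [ENNReal.ofReal_mul (hw l), ← hinner l, ← ENNReal.tsum_mul_left]
  exact tsum_congr fun j => by ring

/-- The function `u` has bounded absolute expectations along the uniformized chain of `d`, from
every initial state. -/
def HasBoundedMeans (d : Q.Policy) (u : ℕ → ℝ) : Prop :=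
  ∀ i, ∃ c, ∀ l, (bdStep Q.upProb (Q.downProb d))^[l] (fun n => |u n|) i ≤ c

theorem HasBoundedMeans.of_le (H : IsBirthDeath Q.upProb (Q.downProb d)) {u v : ℕ → ℝ}
    (hu : HasBoundedMeans d u) (h : ∀ n, |v n| ≤ |u n|) : HasBoundedMeans d v := by
  intro i
  obtain ⟨c, hc⟩ := hu i
  exact ⟨c, fun l => (H.iterate_le (v := fun n => |u n|) h l i).trans (hc l)⟩

theorem HasBoundedMeans.abs_iterate_le (H : IsBirthDeath Q.upProb (Q.downProb d)) {u : ℕ → ℝ}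
    (hu : HasBoundedMeans d u) (i : ℕ) :
    ∃ c, ∀ l, |(bdStep Q.upProb (Q.downProb d))^[l] u i| ≤ c := by
  obtain ⟨c, hc⟩ := hu i
  refine ⟨c, fun l => abs_le.2 ⟨?_, ?_⟩⟩
  · have h1 := H.iterate_le (u := fun n => -|u n|) (v := u) (fun n => neg_abs_le (u n)) l i
    have h2 : (fun n => -|u n|) = (-1 : ℝ) • fun n => |u n| := by ext n; simp
    rw [h2, IsBirthDeath.iterate_smul] at h1
    simp only [Pi.smul_apply, smul_eq_mul] at h1
    linarith [hc l]
  · exact (H.iterate_le (v := fun n => |u n|) (fun n => le_abs_self (u n)) l i).trans (hc l)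

theorem IsMarkovChain.integrable_apply (hX : Q.IsMarkovChain d i P X)
    (H : IsBirthDeath Q.upProb (Q.downProb d)) (hΛ : 0 < Q.unifRate) {u : ℕ → ℝ}
    (hu : HasBoundedMeans d u) {t : ℝ} (ht : 0 ≤ t) : Integrable (fun ω => u (X t ω)) P := by
  obtain ⟨c, hc⟩ := hu i
  refine ⟨((measurable_of_countable u).comp (hX.measurable_apply t)).aestronglyMeasurable, ?_⟩
  rw [hasFiniteIntegral_iff_norm]
  simp only [Real.norm_eq_abs]
  rw [hX.lintegral_eq H hΛ (u := fun n => |u n|) (fun n => abs_nonneg _) hc ht]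
  exact ENNReal.ofReal_lt_top

theorem IsMarkovChain.integral_eq (hX : Q.IsMarkovChain d i P X)
    (H : IsBirthDeath Q.upProb (Q.downProb d)) (hΛ : 0 < Q.unifRate) {u : ℕ → ℝ}
    (hu : HasBoundedMeans d u) {t : ℝ} (ht : 0 ≤ t) :
    ∫ ω, u (X t ω) ∂P = poissonMean
      (fun l => (bdStep Q.upProb (Q.downProb d))^[l] u i) (Q.unifRate * t) := by
  have hnn : ∀ v : ℕ → ℝ, 0 ≤ v → HasBoundedMeans d v → ∫ ω, v (X t ω) ∂P = poissonMean
      (fun l => (bdStep Q.upProb (Q.downProb d))^[l] v i) (Q.unifRate * t) := by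
    intro v hv hbv
    obtain ⟨c, hc⟩ := hbv i
    simp only [abs_of_nonneg (hv _)] at hc
    rw [integral_eq_lintegral_of_nonneg_ae (f := fun ω => v (X t ω)) (Eventually.of_forall fun ω => hv _)
      ((measurable_of_countable v).comp (hX.measurable_apply t)).aestronglyMeasurable,
      hX.lintegral_eq H hΛ hv hc ht, ENNReal.toReal_ofReal]
    exact tsum_nonneg fun l => mul_nonneg
      (poissonMean.weight_nonneg (mul_nonneg hΛ.le ht) l) (H.iterate_nonneg hv l i)
  have h1 : HasBoundedMeans d fun n => max (u n) 0 := hu.of_le H fun n => by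
    rw [abs_of_nonneg (le_max_right _ _)]
    exact max_le (le_abs_self _) (abs_nonneg _)
  have h2 : HasBoundedMeans d fun n => max (-u n) 0 := hu.of_le H fun n => by
    rw [abs_of_nonneg (le_max_right _ _)]
    exact max_le (neg_le_abs _) (abs_nonneg _)
  have h3 : u = (fun n => max (u n) 0) - fun n => max (-u n) 0 := by
    ext n
    exact (max_zero_sub_max_neg_zero_eq_self (u n)).symm
  obtain ⟨c₁, hc₁⟩ := h1.abs_iterate_le H i
  obtain ⟨c₂, hc₂⟩ := h2.abs_iterate_le H i
  have h4 := poissonMean.sub hc₁ hc₂ (Q.unifRate * t)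
  have h5 : ∫ ω, u (X t ω) ∂P = ∫ ω, max (u (X t ω)) 0 ∂P - ∫ ω, max (-u (X t ω)) 0 ∂P := by
    rw [← integral_sub (hX.integrable_apply H hΛ h1 ht) (hX.integrable_apply H hΛ h2 ht)]
    exact integral_congr_ae (Eventually.of_forall fun ω => congrFun h3 _)
  rw [h5, hnn (fun n => max (u n) 0) (fun n => le_max_right _ _) h1,
    hnn (fun n => max (-u n) 0) (fun n => le_max_right _ _) h2, ← h4]
  congr 1
  ext l
  conv_rhs => rw [h3, iterate_map_sub]
  rfl

theorem IsMarkovChain.integrable_prod (hX : Q.IsMarkovChain d i P X)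
    (H : IsBirthDeath Q.upProb (Q.downProb d)) (hΛ : 0 < Q.unifRate) {u : ℕ → ℝ}
    (hu : HasBoundedMeans d u) (T : ℝ) :
    Integrable (fun p : ℝ × Ω => u (X p.1 p.2)) ((volume.restrict (Set.Ioc 0 T)).prod P) := by
  have := hX.isProbabilityMeasure
  obtain ⟨c, hc⟩ := hu i
  have hm : Measurable fun p : ℝ × Ω => u (X p.1 p.2) :=
    (measurable_of_countable u).comp hX.measurable
  refine ⟨hm.aestronglyMeasurable, ?_⟩
  rw [hasFiniteIntegral_iff_norm]
  simp only [Real.norm_eq_abs]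
  rw [lintegral_prod _ (hm.abs.ennreal_ofReal).aemeasurable]
  have h : ∀ t ∈ Set.Ioc 0 T, ∫⁻ ω, ENNReal.ofReal |u (X t ω)| ∂P ≤ ENNReal.ofReal c := by
    intro t ht
    rw [hX.lintegral_eq H hΛ (u := fun n => |u n|) (fun n => abs_nonneg _) hc ht.1.le]
    refine ENNReal.ofReal_le_ofReal ((le_abs_self _).trans (poissonMean.abs_le (fun l => ?_)
      (mul_nonneg hΛ.le ht.1.le)))
    rw [abs_of_nonneg (H.iterate_nonneg (fun n => abs_nonneg _) l i)]
    exact hc l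
  refine (setLIntegral_mono measurable_const h).trans_lt ?_
  rw [setLIntegral_const]
  exact ENNReal.mul_lt_top ENNReal.ofReal_lt_top (by simp)

theorem IsMarkovChain.integral_integral_eq (hX : Q.IsMarkovChain d i P X)
    (H : IsBirthDeath Q.upProb (Q.downProb d)) (hΛ : 0 < Q.unifRate) {u : ℕ → ℝ}
    (hu : HasBoundedMeans d u) {T : ℝ} (hT : 0 ≤ T) :
    ∫ ω, (∫ t in (0 : ℝ)..T, u (X t ω)) ∂P = ∫ t in (0 : ℝ)..T, poissonMean
      (fun l => (bdStep Q.upProb (Q.downProb d))^[l] u i) (Q.unifRate * t) := by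
  have := hX.isProbabilityMeasure
  simp only [intervalIntegral.integral_of_le hT]
  rw [← integral_integral_swap (hX.integrable_prod H hΛ hu T)]
  exact setIntegral_congr_fun measurableSet_Ioc fun t ht => hX.integral_eq H hΛ hu ht.1.le

theorem IsMarkovChain.tendsto_average (hX : Q.IsMarkovChain d i P X)
    (H : IsBirthDeath Q.upProb (Q.downProb d)) (hΛ : 0 < Q.unifRate) {u : ℕ → ℝ}
    (hu : HasBoundedMeans d u) {C : ℝ}
    (hC : Tendsto (fun l => (bdStep Q.upProb (Q.downProb d))^[l] u i) atTop (𝓝 C)) :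
    Tendsto (fun T : ℝ => ∫ ω, (1 / T) * (∫ t in (0 : ℝ)..T, u (X t ω)) ∂P) atTop (𝓝 C) := by
  obtain ⟨c, hc⟩ := hu.abs_iterate_le H i
  have h1 := tendsto_time_average (φ := fun t => poissonMean
      (fun l => (bdStep Q.upProb (Q.downProb d))^[l] u i) (Q.unifRate * t)) (c := c)
    ((poissonMean.continuous hc).comp (continuous_const_mul _))
    (fun t ht => poissonMean.abs_le hc (mul_nonneg hΛ.le ht))
    ((poissonMean.tendsto hc hC).comp (tendsto_id.const_mul_atTop hΛ))
  refine h1.congr' ?_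
  filter_upwards [eventually_ge_atTop 0] with T hT
  rw [integral_const_mul, hX.integral_integral_eq H hΛ hu hT]

theorem integral_time_average_eq [IsProbabilityMeasure P] {v : ℝ × Ω → ℝ} {T : ℝ} (hT : 0 ≤ T)
    (hv : Integrable v ((volume.restrict (Set.Ioc 0 T)).prod P)) :
    ∫ ω, (1 / T) * (∫ t in (0 : ℝ)..T, v (t, ω)) ∂P =
      (1 / T) * ∫ p, v p ∂((volume.restrict (Set.Ioc 0 T)).prod P) := by
  rw [integral_const_mul, integral_prod_symm _ hv]
  simp only [intervalIntegral.integral_of_le hT]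

/-- A lower bound of the cost rate by a function with convergent means bounds its limit by the
long-run average cost. -/
theorem HasAverageCost.limit_le {P : Q.Policy → ℕ → Measure Ω} {η : ℝ}
    (hη : Q.HasAverageCost P X d η) (hX : Q.IsMarkovChain d i (P d i) X)
    (H : IsBirthDeath Q.upProb (Q.downProb d)) (hΛ : 0 < Q.unifRate) {u : ℕ → ℝ}
    (hu : HasBoundedMeans d u) (hle : ∀ n, u n ≤ Q.costRate n (d n)) {C : ℝ}
    (hC : Tendsto (fun l => (bdStep Q.upProb (Q.downProb d))^[l] u i) atTop (𝓝 C)) : C ≤ η := by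
  have := hX.isProbabilityMeasure
  refine le_of_tendsto_of_tendsto (hX.tendsto_average H hΛ hu hC) (hη i).2 ?_
  filter_upwards [eventually_ge_atTop 0] with T hT
  have h1 := hX.integrable_prod H hΛ hu T
  have h2 := (hη i).1 T
  rw [integral_time_average_eq hT h1, integral_time_average_eq hT h2]
  exact mul_le_mul_of_nonneg_left (integral_mono h1 h2 fun p => hle _) (by positivity)

/-- The backward equation, integrated over `[0, T]`. -/
theorem generator_integral_poissonMean (H : IsBirthDeath Q.upProb (Q.downProb d))
    (hΛ : 0 < Q.unifRate) {u : ℕ → ℝ} (hu : HasBoundedMeans d u) (T : ℝ) (n : ℕ) :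
    Q.generator d (fun i => ∫ t in (0 : ℝ)..T, poissonMean
      (fun l => (bdStep Q.upProb (Q.downProb d))^[l] u i) (Q.unifRate * t)) n =
      poissonMean (fun l => (bdStep Q.upProb (Q.downProb d))^[l] u n) (Q.unifRate * T) - u n := by
  choose c hc using fun i => hu.abs_iterate_le H i
  have hcont : ∀ i, Continuous fun t => poissonMean
      (fun l => (bdStep Q.upProb (Q.downProb d))^[l] u i) (Q.unifRate * t) :=
    fun i => (poissonMean.continuous (hc i)).comp (continuous_const_mul _)
  have hint := fun i => (hcont i).intervalIntegrable (μ := volume) 0 T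
  have hderiv : ∀ t, HasDerivAt (fun t => poissonMean
      (fun l => (bdStep Q.upProb (Q.downProb d))^[l] u n) (Q.unifRate * t))
      (Q.lam * (poissonMean (fun l => (bdStep Q.upProb (Q.downProb d))^[l] u (n + 1))
          (Q.unifRate * t) -
        poissonMean (fun l => (bdStep Q.upProb (Q.downProb d))^[l] u n) (Q.unifRate * t)) +
      Q.serviceRate (d n) * (poissonMean (fun l => (bdStep Q.upProb (Q.downProb d))^[l] u (n - 1))
          (Q.unifRate * t) -
        poissonMean (fun l => (bdStep Q.upProb (Q.downProb d))^[l] u n) (Q.unifRate * t))) t := by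
    intro t
    have h1 := (poissonMean.hasDerivAt (hc n) (Q.unifRate * t)).comp t
      ((hasDerivAt_id t).const_mul Q.unifRate)
    refine h1.congr_deriv ?_
    rw [mul_one, mul_comm _ Q.unifRate, ← poissonMean.const_mul, ← poissonMean.sub (hc _) (hc _),
      ← poissonMean.sub (hc _) (hc _), ← poissonMean.const_mul, ← poissonMean.const_mul]
    have h2 : ∀ m (r : ℝ) l, |r * ((bdStep Q.upProb (Q.downProb d))^[l] u m -
        (bdStep Q.upProb (Q.downProb d))^[l] u n)| ≤ |r| * (c m + c n) := fun m r l => by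
      rw [abs_mul]
      exact mul_le_mul_of_nonneg_left ((abs_sub _ _).trans (add_le_add (hc m l) (hc n l)))
        (abs_nonneg r)
    rw [poissonMean, poissonMean, poissonMean, ← (poissonMean.summable (h2 _ _) _).tsum_add
      (poissonMean.summable (h2 _ _) _)]
    refine tsum_congr fun l => ?_
    rw [Function.iterate_succ_apply', bdStep_apply, upProb, downProb]
    field_simp
    ring
  have hftc := intervalIntegral.integral_eq_sub_of_hasDerivAt (a := 0) (b := T)
    (fun t _ => hderiv t) (Continuous.intervalIntegrable (by
      have := hcont n; have := hcont (n + 1); have := hcont (n - 1); fun_prop) _ _)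
  rw [mul_zero, poissonMean.zero, Function.iterate_zero, id_eq,
    intervalIntegral.integral_add (((hint _).sub (hint _)).const_mul _)
      (((hint _).sub (hint _)).const_mul _),
    intervalIntegral.integral_const_mul, intervalIntegral.integral_const_mul,
    intervalIntegral.integral_sub (hint _) (hint _),
    intervalIntegral.integral_sub (hint _) (hint _)] at hftc
  exact hftc

/-- The performance potential solves the Poisson equation, as soon as the means of the cost rate
converge to the average cost. -/
theorem IsPotential.isRelativeValue {P : Q.Policy → ℕ → Measure Ω} {η : ℝ} {g : ℕ → ℝ}
    (hg : Q.IsPotential P X d η g) (hX : ∀ n, Q.IsMarkovChain d n (P d n) X)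
    (H : IsBirthDeath Q.upProb (Q.downProb d)) (hΛ : 0 < Q.unifRate)
    (hf : HasBoundedMeans d fun n => Q.costRate n (d n) - η)
    (hlim : ∀ i, Tendsto (fun l => (bdStep Q.upProb (Q.downProb d))^[l]
      (fun n => Q.costRate n (d n) - η) i) atTop (𝓝 0)) : Q.IsRelativeValue d η g := by
  intro n
  have hV : ∀ i, Tendsto (fun T : ℝ => ∫ t in (0 : ℝ)..T, poissonMean
      (fun l => (bdStep Q.upProb (Q.downProb d))^[l] (fun n => Q.costRate n (d n) - η) i)
      (Q.unifRate * t)) atTop (𝓝 (g i)) := by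
    intro i
    refine (hg i).congr' ?_
    filter_upwards [eventually_ge_atTop 0] with T hT
    exact (hX i).integral_integral_eq H hΛ hf hT
  -- The generator at `n` sees only three states, so pointwise convergence of the truncated
  -- potentials suffices.
  have h1 : Tendsto (fun T => Q.generator d (fun i => ∫ t in (0 : ℝ)..T, poissonMean
      (fun l => (bdStep Q.upProb (Q.downProb d))^[l] (fun n => Q.costRate n (d n) - η) i)
      (Q.unifRate * t)) n) atTop (𝓝 (Q.generator d g n)) :=
    (((hV _).sub (hV _)).const_mul _).add (((hV _).sub (hV _)).const_mul _)
  obtain ⟨c, hc⟩ := hf.abs_iterate_le H n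
  have h2 := ((poissonMean.tendsto hc (hlim n)).comp
    (tendsto_id.const_mul_atTop hΛ)).sub_const (Q.costRate n (d n) - η)
  have h3 := tendsto_nhds_unique h1 (h2.congr fun T =>
    (generator_integral_poissonMean H hΛ hf T n).symm)
  rw [h3]
  ring

end Law

/-! ### Means of the cost rate and strict policy improvement. -/

/-- The operating cost rate of an action. -/
def operatingCost (Q : GroupServerQueue) (m : Q.Action) : ℝ := ∑ k, (m k : ℝ) * Q.c k

theorem costRate_eq (n : ℕ) (m : Q.Action) : Q.costRate n m = Q.h n + Q.operatingCost m := rfl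

theorem operatingCost_nonneg (hc : ∀ k, 0 ≤ Q.c k) (m : Q.Action) : 0 ≤ Q.operatingCost m :=
  Finset.sum_nonneg fun k _ => mul_nonneg (Nat.cast_nonneg _) (hc k)

theorem operatingCost_le (hc : ∀ k, 0 ≤ Q.c k) {n : ℕ} {m : Q.Action}
    (hm : m ∈ Q.efficientActions n) : Q.operatingCost m ≤ Q.operatingCost Q.M :=
  Finset.sum_le_sum fun k _ => mul_le_mul_of_nonneg_right (Nat.cast_le.2 (hm.1 k)) (hc k)

theorem eq_zero_of_serviceRate_eq_zero (hmu : ∀ k, 0 < Q.mu k) {m : Q.Action}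
    (hm : Q.serviceRate m = 0) : m = 0 := by
  ext k
  have := (Finset.sum_eq_zero_iff_of_nonneg fun k _ =>
    mul_nonneg (Nat.cast_nonneg (m k)) (hmu k).le).1 hm k (Finset.mem_univ k)
  simpa [(hmu k).ne'] using this

theorem serviceRate_zero : Q.serviceRate 0 = 0 := by simp [serviceRate]

theorem operatingCost_zero : Q.operatingCost 0 = 0 := by simp [operatingCost]

theorem serviceRate_single (k : Fin Q.K) : Q.serviceRate (Pi.single k 1) = Q.mu k := by
  simp [serviceRate, Pi.single_apply]

theorem operatingCost_single (k : Fin Q.K) : Q.operatingCost (Pi.single k 1) = Q.c k := by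
  simp [operatingCost, Pi.single_apply]

theorem serviceRate_add (m m' : Q.Action) :
    Q.serviceRate (m + m') = Q.serviceRate m + Q.serviceRate m' := by
  simp [serviceRate, add_mul, Finset.sum_add_distrib]

theorem operatingCost_add (m m' : Q.Action) :
    Q.operatingCost (m + m') = Q.operatingCost m + Q.operatingCost m' := by
  simp [operatingCost, add_mul, Finset.sum_add_distrib]

/-- A convex function of a nonnegative integer that tends to infinity grows at least linearly. -/
theorem _root_.ConvexSeq.exists_linear_le {h : ℕ → ℝ} (hmono : Monotone h) (hconv : ConvexSeq h)
    (hlim : Tendsto h atTop atTop) : ∃ s > 0, ∃ C, ∀ n : ℕ, s * n ≤ h n - h 0 + C := by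
  have hex : ∃ N, h N < h (N + 1) := by
    by_contra! hcon
    obtain ⟨n, hn⟩ := (hlim.eventually_gt_atTop (h 0)).exists
    exact hn.not_ge (antitone_nat_of_succ_le hcon (Nat.zero_le n))
  obtain ⟨N, hN⟩ := hex
  have hslope : ∀ n, N ≤ n → h (N + 1) - h N ≤ h (n + 1) - h n := by
    intro n hn
    induction n, hn using Nat.le_induction with
    | base => exact le_rfl
    | succ n _ ih => linarith [hconv n]
  refine ⟨h (N + 1) - h N, sub_pos.2 hN, (h (N + 1) - h N) * N, fun n => ?_⟩
  rcases le_total n N with hn | hn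
  · have h1 : (n : ℝ) ≤ N := Nat.cast_le.2 hn
    have h2 := mul_le_mul_of_nonneg_left h1 (sub_pos.2 hN).le
    linarith [hmono (Nat.zero_le n)]
  · induction n, hn using Nat.le_induction with
    | base => linarith [hmono (Nat.zero_le N)]
    | succ n hn ih =>
      push_cast
      linarith [hslope n hn]

section Policy

variable {d : Q.Policy}

theorem HasBoundedMeans.of_nonneg (H : IsBirthDeath Q.upProb (Q.downProb d)) {u : ℕ → ℝ}
    (hu : 0 ≤ u) {c : ℝ} (hc : ∀ l, (bdStep Q.upProb (Q.downProb d))^[l] u 0 ≤ c) :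
    HasBoundedMeans d u := by
  have : (fun n => |u n|) = u := funext fun n => abs_of_nonneg (hu n)
  intro i
  rw [this]
  exact H.exists_iterate_le hu hc i

theorem HasBoundedMeans.of_bounded (H : IsBirthDeath Q.upProb (Q.downProb d)) {u : ℕ → ℝ} {c : ℝ}
    (hu : ∀ n, |u n| ≤ c) : HasBoundedMeans d u :=
  fun i => ⟨c, fun l => H.iterate_le_const hu l i⟩

/-- If the means of the holding cost are bounded, then the means of the cost rate are bounded and
converge. -/
theorem exists_tendsto_costRate (hc : ∀ k, 0 ≤ Q.c k)
    (h_mono : Monotone Q.h) (h_convex : ConvexSeq Q.h) (h_tendsto : Tendsto Q.h atTop atTop)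
    (H : IsBirthDeath Q.upProb (Q.downProb d)) (hd : d ∈ Q.efficientPolicies) {C : ℝ}
    (hC : ∀ l, (bdStep Q.upProb (Q.downProb d))^[l] (Q.h - fun _ => Q.h 0) 0 ≤ C) :
    HasBoundedMeans d (fun n => Q.costRate n (d n)) ∧
    ∃ η, ∀ i, Tendsto (fun l => (bdStep Q.upProb (Q.downProb d))^[l]
      (fun n => Q.costRate n (d n)) i) atTop (𝓝 η) := by
  have h0 : ∀ n, 0 ≤ Q.h n - Q.h 0 := fun n => sub_nonneg.2 (h_mono (Nat.zero_le n))
  have hB0 := fun n => operatingCost_nonneg hc (d n)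
  have hB := fun n => operatingCost_le hc (hd n)
  set B := Q.operatingCost Q.M
  have hBnn : 0 ≤ B := (hB0 0).trans (hB 0)
  constructor
  · refine HasBoundedMeans.of_le (u := (Q.h - fun _ => Q.h 0) + fun _ => B + |Q.h 0|) H
      (HasBoundedMeans.of_nonneg H (c := C + (B + |Q.h 0|)) ?_ fun l => ?_) fun n => ?_
    · exact add_nonneg h0 fun n => add_nonneg hBnn (abs_nonneg _)
    · rw [iterate_map_add, IsBirthDeath.iterate_const]
      exact add_le_add_left (hC l) _
    · rw [costRate_eq, Pi.add_apply, Pi.sub_apply, abs_of_nonneg (a := _ + _)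
        (add_nonneg (h0 n) (add_nonneg hBnn (abs_nonneg _)))]
      exact abs_le.2 ⟨by linarith [h0 n, hB0 n, neg_abs_le (Q.h 0), abs_nonneg (Q.h 0)],
        by linarith [hB n, le_abs_self (Q.h 0)]⟩
  · obtain ⟨s, hs, C', hC'⟩ := ConvexSeq.exists_linear_le h_mono h_convex h_tendsto
    -- Operating costs need not be monotone in the state. They lie in `[0, B]`, so adding `B * n`
    -- makes the cost rate monotone; the means of `B * n` are bounded since `h` grows at least
    -- linearly. The limit is then a difference of two monotone limits.
    have hlin : ∀ l, (bdStep Q.upProb (Q.downProb d))^[l] (fun n : ℕ => B * n) 0 ≤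
        B / s * (C + C') := by
      intro l
      have h1 := H.iterate_le (u := fun n : ℕ => B * n)
        (v := (B / s) • ((Q.h - fun _ => Q.h 0) + fun _ => C')) (fun n => by
          have := mul_le_mul_of_nonneg_left (hC' n) (div_nonneg hBnn hs.le)
          simp only [Pi.smul_apply, Pi.add_apply, Pi.sub_apply, smul_eq_mul]
          refine le_trans (le_of_eq ?_) this
          field_simp) l 0
      rw [IsBirthDeath.iterate_smul, iterate_map_add, IsBirthDeath.iterate_const] at h1
      refine h1.trans ?_
      simp only [Pi.smul_apply, Pi.add_apply, smul_eq_mul]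
      exact mul_le_mul_of_nonneg_left (add_le_add_left (hC l) _) (div_nonneg hBnn hs.le)
    obtain ⟨C₂, hC₂⟩ := H.exists_tendsto (u := fun n : ℕ => B * n)
      (fun n => mul_nonneg hBnn (Nat.cast_nonneg n))
      (fun m n hmn => mul_le_mul_of_nonneg_left (Nat.cast_le.2 hmn) hBnn) hlin
    have hsplit : (fun n => Q.costRate n (d n)) + (fun n : ℕ => B * n) - (fun _ => Q.h 0) ≤
        (Q.h - fun _ => Q.h 0) + (fun _ => B) + fun n : ℕ => B * n := by
      intro n
      simp only [Pi.add_apply, Pi.sub_apply, costRate_eq]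
      linarith [hB n]
    obtain ⟨C₁, hC₁⟩ := H.exists_tendsto
      (u := (fun n => Q.costRate n (d n)) + (fun n : ℕ => B * n) - (fun _ => Q.h 0))
      (c := C + B + B / s * (C + C'))
      (fun n => by
        have := mul_nonneg hBnn (Nat.cast_nonneg (α := ℝ) n)
        simp only [Pi.add_apply, Pi.sub_apply, costRate_eq, Pi.zero_apply]
        linarith [h0 n, hB0 n])
      (monotone_nat_of_le_succ fun n => by
        simp only [Pi.add_apply, Pi.sub_apply, costRate_eq]
        push_cast
        linarith [hB n, hB0 (n + 1), h_mono (Nat.le_succ n)])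
      (fun l => by
        refine (H.iterate_le hsplit l 0).trans ?_
        rw [iterate_map_add, iterate_map_add, IsBirthDeath.iterate_const]
        exact add_le_add (add_le_add_left (hC l) _) (hlin l))
    refine ⟨C₁ - C₂ + Q.h 0, fun i => (((hC₁ i).sub (hC₂ i)).add_const (Q.h 0)).congr fun l => ?_⟩
    rw [iterate_map_sub, iterate_map_add, IsBirthDeath.iterate_const]
    simp only [Pi.add_apply, Pi.sub_apply]
    ring

variable {Ω : Type*} [MeasurableSpace Ω] {P : Q.Policy → ℕ → Measure Ω} {X : ℝ → Ω → ℕ}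

theorem hasAverageCost_of_tendsto (hX : ∀ n, Q.IsMarkovChain d n (P d n) X)
    (H : IsBirthDeath Q.upProb (Q.downProb d)) (hΛ : 0 < Q.unifRate)
    (hf : HasBoundedMeans d fun n => Q.costRate n (d n)) {η : ℝ}
    (hη : ∀ i, Tendsto (fun l => (bdStep Q.upProb (Q.downProb d))^[l]
      (fun n => Q.costRate n (d n)) i) atTop (𝓝 η)) : Q.HasAverageCost P X d η :=
  fun n => ⟨fun T => (hX n).integrable_prod H hΛ hf T, (hX n).tendsto_average H hΛ hf (hη n)⟩

/-- Under a policy with finite average cost, the means of the holding cost are bounded. -/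
theorem HasAverageCost.iterate_holding_le {η : ℝ} (hη : Q.HasAverageCost P X d η)
    (hX : ∀ n, Q.IsMarkovChain d n (P d n) X) (hc : ∀ k, 0 ≤ Q.c k) (h_mono : Monotone Q.h)
    (H : IsBirthDeath Q.upProb (Q.downProb d)) (hΛ : 0 < Q.unifRate) (l : ℕ) :
    (bdStep Q.upProb (Q.downProb d))^[l] (Q.h - fun _ => Q.h 0) 0 ≤ η - Q.h 0 := by
  have h0 : ∀ n, 0 ≤ Q.h n - Q.h 0 := fun n => sub_nonneg.2 (h_mono (Nat.zero_le n))
  -- Truncation supplies the bounded means that are not yet known for `h`. From state `0` every mean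
  -- lies below its limit, which the average cost controls.
  have htrunc : ∀ N : ℕ, (bdStep Q.upProb (Q.downProb d))^[l]
      (fun n => min (Q.h n - Q.h 0) N) 0 ≤ η - Q.h 0 := by
    intro N
    have hmono : Monotone fun n => min (Q.h n - Q.h 0) (N : ℝ) := fun m n hmn =>
      min_le_min_right _ (sub_le_sub_right (h_mono hmn) _)
    have hnn : ∀ n, 0 ≤ min (Q.h n - Q.h 0) (N : ℝ) := fun n => le_min (h0 n) (Nat.cast_nonneg N)
    obtain ⟨C, hC⟩ := H.exists_tendsto hnn hmono (c := N)
      fun l => H.iterate_le_const (fun n => min_le_right _ _) l 0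
    have h1 := (H.monotone_iterate hmono H.zero).ge_of_tendsto (hC 0) l
    have h2 := hη.limit_le (i := 0) (u := (fun n => min (Q.h n - Q.h 0) (N : ℝ)) + fun _ => Q.h 0)
      (C := C + Q.h 0) (hX 0) H hΛ
      (HasBoundedMeans.of_bounded H (c := N + |Q.h 0|) fun n => by
        refine (abs_add_le _ _).trans (add_le_add_left ?_ _)
        rw [abs_of_nonneg (hnn n)]
        exact min_le_right _ _)
      (fun n => by
        rw [costRate_eq, Pi.add_apply]
        linarith [min_le_left (Q.h n - Q.h 0) (N : ℝ), operatingCost_nonneg hc (d n)])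
      (by
        simp only [iterate_map_add, IsBirthDeath.iterate_const]
        exact (hC 0).add_const _)
    linarith
  refine le_of_tendsto' (IsBirthDeath.tendsto_iterate_of_tendsto (fun i => ?_) l 0) htrunc
  refine tendsto_const_nhds.congr' ?_
  obtain ⟨N, hN⟩ := exists_nat_ge (Q.h i - Q.h 0)
  filter_upwards [eventually_ge_atTop N] with N' hN'
  exact (min_eq_left (hN.trans (Nat.cast_le.2 hN'))).symm

/-- Under a policy with finite average cost, the means of the cost rate converge to it. -/
theorem HasAverageCost.tendsto_costRate {η : ℝ} (hη : Q.HasAverageCost P X d η)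
    (hX : ∀ n, Q.IsMarkovChain d n (P d n) X) (hc : ∀ k, 0 ≤ Q.c k)
    (h_mono : Monotone Q.h) (h_convex : ConvexSeq Q.h) (h_tendsto : Tendsto Q.h atTop atTop)
    (H : IsBirthDeath Q.upProb (Q.downProb d)) (hΛ : 0 < Q.unifRate)
    (hd : d ∈ Q.efficientPolicies) :
    HasBoundedMeans d (fun n => Q.costRate n (d n)) ∧
    ∀ i, Tendsto (fun l => (bdStep Q.upProb (Q.downProb d))^[l]
      (fun n => Q.costRate n (d n)) i) atTop (𝓝 η) := by
  obtain ⟨hb, C, hC⟩ := exists_tendsto_costRate hc h_mono h_convex h_tendsto H hd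
    (hη.iterate_holding_le hX hc h_mono H hΛ)
  have := tendsto_nhds_unique ((hX 0).tendsto_average H hΛ hb (hC 0)) (hη 0).2
  exact ⟨hb, this ▸ hC⟩

theorem bdStep_smul_unifRate (hΛ : 0 < Q.unifRate) (g : ℕ → ℝ) :
    bdStep Q.upProb (Q.downProb d) (Q.unifRate • g) = Q.unifRate • g + Q.generator d g := by
  ext n
  rw [bdStep_apply, upProb, downProb, Pi.add_apply, generator]
  simp only [Pi.smul_apply, smul_eq_mul]
  field_simp
  ring

/-- An optimal policy cannot be improved: there is no efficient policy with a drift function that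
witnesses a gain in a recurrent state `m`. -/
theorem IsOptimal.not_improvable {η : ℝ} (hlam : 0 < Q.lam) (hmu : ∀ k, 0 < Q.mu k)
    (hc : ∀ k, 0 ≤ Q.c k)
    (h_mono : Monotone Q.h) (h_convex : ConvexSeq Q.h) (h_tendsto : Tendsto Q.h atTop atTop)
    (hX : ∀ d ∈ Q.efficientPolicies, ∀ n, Q.IsMarkovChain d n (P d n) X)
    (hopt : Q.IsOptimal P X d η) {d' : Q.Policy} (hd' : d' ∈ Q.efficientPolicies) {g : ℕ → ℝ}
    {N : ℕ} (hg : ∀ k, N ≤ k → g k ≤ g (k + 1)) {m : ℕ}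
    (hm : ∀ j, m < j → 0 < Q.serviceRate (d' j)) {ε : ℝ} (hε : 0 < ε)
    (hdrift : ∀ n, n ≠ m → Q.costRate n (d' n) - η + Q.generator d' g n ≤ 0)
    (hgain : Q.costRate m (d' m) - η + Q.generator d' g m ≤ -ε) : False := by
  have hΛ := unifRate_pos hlam hmu
  have H := isBirthDeath hlam hmu hd'
  obtain ⟨c, hc'⟩ := exists_lower_bound_of_eventually_le_succ hg
  have hlow : ∀ k, Q.unifRate * c ≤ (Q.unifRate • g) k := fun k =>
    mul_le_mul_of_nonneg_left (hc' k) hΛ.le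
  have hdr : bdStep Q.upProb (Q.downProb d') (Q.unifRate • g) ≤ Q.unifRate • g -
      (((fun n => Q.costRate n (d' n)) - fun _ => η) + ε • Pi.single m 1) := by
    rw [bdStep_smul_unifRate hΛ]
    intro n
    simp only [Pi.add_apply, Pi.sub_apply, Pi.smul_apply, smul_eq_mul]
    rcases eq_or_ne n m with rfl | hn
    · simp only [Pi.single_eq_same]
      linarith
    · simp only [Pi.single_eq_of_ne hn]
      linarith [hdrift n hn]
  have h0 : 0 ≤ Q.h - fun _ => Q.h 0 := fun n => sub_nonneg.2 (h_mono (Nat.zero_le n))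
  -- Dropping the operating cost and the gain leaves a drift inequality for `h`, so stability of
  -- `d'` is derived rather than assumed.
  obtain ⟨C, hC⟩ := H.exists_iterate_le_of_drift (u := Q.h - fun _ => Q.h 0) (c' := η - Q.h 0)
    h0 (fun i j hij => sub_le_sub_right (h_mono hij) _) hlow
    (hdr.trans fun n => by
      have : 0 ≤ ε * (Pi.single m 1 : ℕ → ℝ) n :=
        mul_nonneg hε.le ((Pi.single_nonneg.2 zero_le_one : 0 ≤ (Pi.single m 1 : ℕ → ℝ)) n)
      simp only [Pi.add_apply, Pi.sub_apply, Pi.smul_apply, smul_eq_mul, costRate_eq]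
      linarith [operatingCost_nonneg hc (d' n)])
  obtain ⟨hb, η', hη'⟩ := exists_tendsto_costRate hc h_mono h_convex h_tendsto H hd' hC
  obtain ⟨p, hp⟩ := H.exists_isLimitLaw
  have hlim : Tendsto (Q.h - fun _ => Q.h 0) atTop atTop :=
    (tendsto_atTop_add_const_right atTop (-Q.h 0) h_tendsto).congr fun n =>
      (sub_eq_add_neg _ _).symm
  have hpm : 0 < p m := H.law_pos hp (H.exists_law_pos hp h0 hlim hC)
    (fun j hj => div_pos (hm j hj) hΛ) le_rfl
  have h1 := H.limit_le_of_drift (C := η' - η) hp hlow hdr (by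
    simp only [iterate_map_sub, IsBirthDeath.iterate_const]
    exact (hη' 0).sub_const η)
  have h2 := hopt.le d' hd' η' (hasAverageCost_of_tendsto (hX d' hd') H hΛ hb hη')
  linarith [mul_pos hε hpm]

end Policy

/-! ### The one-state maximization problem and the shape of its solutions. -/

/-- The net gain of an action if a service completion is worth `x`. -/
def gain (Q : GroupServerQueue) (x : ℝ) (m : Q.Action) : ℝ :=
  Q.serviceRate m * x - Q.operatingCost m

/-- The maximal net gain with `n` customers if a service completion is worth `x`. -/
def maxGain (Q : GroupServerQueue) (n : ℕ) (x : ℝ) : ℝ :=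
  sSup (Q.gain x '' Q.efficientActions n)

theorem zero_mem_efficientActions (n : ℕ) : (0 : Q.Action) ∈ Q.efficientActions n :=
  ⟨fun k => Nat.zero_le _, by simp⟩

theorem finite_efficientActions (n : ℕ) : (Q.efficientActions n).Finite :=
  (Set.finite_Iic Q.M).subset fun _ hm => hm.1

theorem le_maxGain {n : ℕ} {m : Q.Action} (hm : m ∈ Q.efficientActions n) (x : ℝ) :
    Q.gain x m ≤ Q.maxGain n x :=
  le_csSup ((finite_efficientActions n).image _).bddAbove ⟨m, hm, rfl⟩

theorem exists_gain_eq_maxGain (n : ℕ) (x : ℝ) :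
    ∃ m ∈ Q.efficientActions n, Q.gain x m = Q.maxGain n x :=
  Set.Nonempty.csSup_mem (Set.Nonempty.image _ ⟨0, zero_mem_efficientActions n⟩)
    ((finite_efficientActions n).image (Q.gain x))

theorem gain_le_gain (hmu : ∀ k, 0 < Q.mu k) {x y : ℝ} (hxy : x ≤ y) (m : Q.Action) :
    Q.gain x m ≤ Q.gain y m :=
  sub_le_sub_right (mul_le_mul_of_nonneg_left hxy (serviceRate_nonneg hmu m)) _

theorem gain_add (x : ℝ) (m m' : Q.Action) : Q.gain x (m + m') = Q.gain x m + Q.gain x m' := by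
  simp only [gain, serviceRate_add, operatingCost_add]
  ring

theorem maxGain_mono (hmu : ∀ k, 0 < Q.mu k) {n n' : ℕ} (hn : n ≤ n') {x y : ℝ} (hxy : x ≤ y) :
    Q.maxGain n x ≤ Q.maxGain n' y := by
  obtain ⟨m, hm, h⟩ := exists_gain_eq_maxGain (Q := Q) n x
  rw [← h]
  exact (gain_le_gain hmu hxy m).trans (le_maxGain ⟨hm.1, hm.2.trans hn⟩ y)

theorem maxGain_zero (x : ℝ) : Q.maxGain 0 x = 0 := by
  obtain ⟨m, hm, h⟩ := exists_gain_eq_maxGain (Q := Q) 0 x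
  rw [← h, eq_zero_of_mem_efficientActions_zero hm, gain, serviceRate_zero, operatingCost_zero]
  ring

/-- The marginal gain of an additional customer decreases with the number of customers and increases
with the value of a service completion. -/
theorem maxGain_succ_sub_le (hmu : ∀ k, 0 < Q.mu k) {n n' : ℕ} (hn : n ≤ n') {x y : ℝ}
    (hxy : x ≤ y) :
    Q.maxGain (n' + 1) x - Q.maxGain n' x ≤ Q.maxGain (n + 1) y - Q.maxGain n y := by
  obtain ⟨m, hm, hmg⟩ := exists_gain_eq_maxGain (Q := Q) (n' + 1) x
  obtain ⟨p, hp, hpg⟩ := exists_gain_eq_maxGain (Q := Q) n y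
  -- Exchange argument: if `m` uses all `n' + 1` customers, some group has more working servers in
  -- `m` than in `p`. Moving one such server from `m` to `p` keeps both feasible, and it gains at
  -- least as much at `y`. Otherwise `m` is already feasible for `n'`, and the left side is at most
  -- `0`.
  rcases Nat.lt_or_ge n' (∑ k, m k) with hsum | hsum
  · obtain ⟨k, -, hk⟩ : ∃ k ∈ Finset.univ, p k < m k :=
      Finset.exists_lt_of_sum_lt ((hp.2.trans hn).trans_lt hsum)
    have hle : Pi.single k 1 ≤ m := by
      intro j
      rcases eq_or_ne j k with rfl | hj
      · rw [Pi.single_eq_same]; exact Nat.one_le_of_lt hk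
      · rw [Pi.single_eq_of_ne hj]; exact Nat.zero_le _
    obtain ⟨q, rfl⟩ := exists_add_of_le hle
    have hone : ∑ j, (Pi.single k 1 : Q.Action) j = 1 := by simp [Pi.single_apply]
    have hq : q ∈ Q.efficientActions n' := by
      refine ⟨fun j => (Nat.le_add_left _ _).trans (hm.1 j), ?_⟩
      have := hm.2
      simp only [Pi.add_apply, Finset.sum_add_distrib, hone] at this
      omega
    have hp' : Pi.single k 1 + p ∈ Q.efficientActions (n + 1) := by
      refine ⟨fun j => ?_, ?_⟩
      · rcases eq_or_ne j k with rfl | hj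
        · have := hm.1 j
          simp only [Pi.add_apply, Pi.single_eq_same] at this hk ⊢
          omega
        · simpa [Pi.single_eq_of_ne hj] using hp.1 j
      · have := hp.2
        simp only [Pi.add_apply, Finset.sum_add_distrib, hone]
        omega
    have h1 := le_maxGain hq x
    have h2 := le_maxGain hp' y
    rw [gain_add] at hmg h2
    linarith [gain_le_gain hmu hxy (Pi.single k 1 : Q.Action)]
  · have h1 := le_maxGain (Q := Q) ⟨hm.1, hsum⟩ x
    have h2 := maxGain_mono hmu (Nat.le_succ n) (le_refl y)
    linarith

/-- The increments of a solution of the optimality equation are nondecreasing if they are eventually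
nonnegative: a first descent would repeat itself forever. -/
theorem monotone_of_optimality {η : ℝ} (hlam : 0 < Q.lam) (hmu : ∀ k, 0 < Q.mu k)
    (h_convex : ConvexSeq Q.h) {G : ℕ → ℝ} (hG0 : G 0 = 0) (hG1 : 0 ≤ G 1)
    (hG : ∀ n, Q.lam * G (n + 1) = η - Q.h n + Q.maxGain n (G n)) {N : ℕ}
    (hN : ∀ n, N ≤ n → 0 ≤ G n) : Monotone G := by
  refine monotone_nat_of_le_succ fun n => ?_
  induction n with
  | zero => rwa [hG0]
  | succ n ih =>
    by_contra! hcon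
    have hconv : ∀ j, n ≤ j → Q.h (n + 1) - Q.h n ≤ Q.h (j + 1) - Q.h j := by
      intro j hj
      induction j, hj using Nat.le_induction with
      | base => exact le_rfl
      | succ j _ ihj => linarith [h_convex j]
    -- The increment of the optimality equation at `j` is compared with that at `n`: holding cost
    -- increments are larger by convexity, and the marginal gain at `G j ≤ G (n + 1)` is smaller.
    -- The ascent `G n ≤ G (n + 1)` bounds the remaining term.
    have hstep : ∀ j, n + 1 ≤ j → G j ≤ G (n + 1) ∧ G (j + 1) - G j ≤ G (n + 2) - G (n + 1) := by
      intro j hj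
      induction j, hj using Nat.le_induction with
      | base => exact ⟨le_rfl, le_rfl⟩
      | succ j hj ihj =>
        refine ⟨by linarith [ihj.1, ihj.2], ?_⟩
        refine le_of_mul_le_mul_left ?_ hlam
        have h1 := maxGain_mono hmu (le_refl (j + 1))
          (show G (j + 1) ≤ G j by linarith [ihj.2])
        have h2 := maxGain_succ_sub_le hmu (show n ≤ j by omega) ihj.1
        have h3 := maxGain_mono hmu (le_refl n) ih
        linarith [hG (j + 1), hG j, hG (n + 1), hG n, hconv j (by omega)]
    have hlin : ∀ j : ℕ, G (n + 1 + j) ≤ G (n + 1) + j * (G (n + 2) - G (n + 1)) := by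
      intro j
      induction j with
      | zero => simp
      | succ j ihj =>
        have := (hstep (n + 1 + j) (by omega)).2
        push_cast
        rw [← add_assoc]
        linarith
    have hneg : Tendsto (fun j : ℕ => G (n + 1) + j * (G (n + 2) - G (n + 1))) atTop atBot :=
      tendsto_atBot_add_const_left _ _
        (tendsto_natCast_atTop_atTop.atTop_mul_const_of_neg (sub_neg.2 hcon))
    obtain ⟨j, h1, h2⟩ := ((hneg.eventually_lt_atBot 0).and (eventually_ge_atTop N)).exists
    linarith [hlin j, hN (n + 1 + j) (by omega)]

/-- Some group has the least cost `ρ` per service, a lower bound for all actions. -/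
theorem exists_cheapest_group (hmu : ∀ k, 0 < Q.mu k) (hM : ∃ k, 0 < Q.M k) :
    ∃ k, 0 < Q.M k ∧ ∀ n, ∀ m ∈ Q.efficientActions n,
      Q.c k / Q.mu k * Q.serviceRate m ≤ Q.operatingCost m := by
  obtain ⟨k₀, hk₀⟩ := hM
  obtain ⟨k, hk, hmin⟩ := Finset.exists_min_image (Finset.univ.filter fun k => 0 < Q.M k)
    (fun k => Q.c k / Q.mu k) ⟨k₀, by simpa using hk₀⟩
  refine ⟨k, by simpa using hk, fun n m hm => ?_⟩
  rw [serviceRate, operatingCost, Finset.mul_sum]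
  refine Finset.sum_le_sum fun j _ => ?_
  rcases Nat.eq_zero_or_pos (m j) with h | h
  · simp [h]
  · have h1 := hmin j (by simpa using h.trans_le (hm.1 j))
    rw [le_div_iff₀ (hmu j)] at h1
    have := mul_le_mul_of_nonneg_left h1 (Nat.cast_nonneg (α := ℝ) (m j))
    linarith

/-! ### Optimal policies: no idling, optimality equation, conclusion. -/

variable {Ω : Type*} [MeasurableSpace Ω] {P : Q.Policy → ℕ → Measure Ω} {X : ℝ → Ω → ℕ}
  {d : Q.Policy} {η : ℝ} {g : ℕ → ℝ}

theorem IsRelativeValue.eventually_le_succ (hlam : 0 < Q.lam) (hmu : ∀ k, 0 < Q.mu k)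
    (hc : ∀ k, 0 ≤ Q.c k)
    (h_mono : Monotone Q.h) (h_convex : ConvexSeq Q.h) (h_tendsto : Tendsto Q.h atTop atTop)
    (hX : ∀ d ∈ Q.efficientPolicies, ∀ n, Q.IsMarkovChain d n (P d n) X)
    (hd : d ∈ Q.efficientPolicies) (hη : Q.HasAverageCost P X d η)
    (hg : Q.IsRelativeValue d η g) {m : ℕ} (hm : ∀ j, m < j → 0 < Q.serviceRate (d j)) :
    ∃ N, ∀ k, N ≤ k → g k ≤ g (k + 1) := by
  have hΛ := unifRate_pos hlam hmu
  have H := isBirthDeath hlam hmu hd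
  have hlim := (hη.tendsto_costRate (hX d hd) hc h_mono h_convex h_tendsto H hΛ hd).2
  have h0 : 0 ≤ Q.h - fun _ => Q.h 0 := fun n => sub_nonneg.2 (h_mono (Nat.zero_le n))
  have hlimh : Tendsto (Q.h - fun _ => Q.h 0) atTop atTop :=
    (tendsto_atTop_add_const_right atTop (-Q.h 0) h_tendsto).congr fun n =>
      (sub_eq_add_neg _ _).symm
  obtain ⟨p, hp⟩ := H.exists_isLimitLaw
  have hpos : ∀ k, m ≤ k → 0 < p k := fun k hk => H.law_pos hp
    (H.exists_law_pos hp h0 hlimh (hη.iterate_holding_le (hX d hd) hc h_mono H hΛ))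
    (fun j hj => div_pos (hm j hj) hΛ) hk
  obtain ⟨N, hN⟩ := (h_tendsto.eventually_ge_atTop η).exists_forall_of_atTop
  obtain ⟨N', hN'⟩ := H.eventually_le_succ hp hpos (g := Q.unifRate • g)
    (e := (fun n => Q.costRate n (d n)) - fun _ => η) (N := N) (by
      rw [bdStep_smul_unifRate hΛ]
      ext n
      simp only [Pi.add_apply, Pi.sub_apply]
      linarith [hg n])
    (by
      simp only [iterate_map_sub, IsBirthDeath.iterate_const]
      simpa using (hlim 0).sub_const η)
    (fun k hk => by
      simp only [Pi.sub_apply, costRate_eq]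
      linarith [hN k hk, operatingCost_nonneg hc (d k)])
  exact ⟨N', fun k hk => le_of_mul_le_mul_left (hN' k hk) hΛ⟩

/-- A state in which no server works has holding cost at most the average cost. -/
theorem holding_le_of_serviceRate_eq_zero (hlam : 0 < Q.lam) (hmu : ∀ k, 0 < Q.mu k)
    (hc : ∀ k, 0 ≤ Q.c k)
    (h_mono : Monotone Q.h) (h_convex : ConvexSeq Q.h) (h_tendsto : Tendsto Q.h atTop atTop)
    (hX : ∀ d ∈ Q.efficientPolicies, ∀ n, Q.IsMarkovChain d n (P d n) X)
    (hd : d ∈ Q.efficientPolicies) (hη : Q.HasAverageCost P X d η) {j : ℕ}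
    (hj : Q.serviceRate (d j) = 0) : Q.h j ≤ η := by
  have H := isBirthDeath hlam hmu hd
  refine ge_of_tendsto' ((hη.tendsto_costRate (hX d hd) hc h_mono h_convex h_tendsto H
    (unifRate_pos hlam hmu) hd).2 j) fun l => ?_
  -- Started in `j`, the chain never goes below `j`, so the mean holding cost never drops below `h
  -- j`.
  refine (H.monotone_iterate h_mono (j := j) (by rw [downProb, hj, zero_div])
    (Nat.zero_le l)).trans (H.iterate_le (fun n => ?_) l j)
  rw [costRate_eq]
  linarith [operatingCost_nonneg hc (d n)]

/-- An optimal policy that has a relative value function uses some server in every state `n ≥ 1`. -/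
theorem IsOptimal.serviceRate_pos (hlam : 0 < Q.lam) (hmu : ∀ k, 0 < Q.mu k)
    (hc : ∀ k, 0 ≤ Q.c k)
    (h_mono : Monotone Q.h) (h_convex : ConvexSeq Q.h) (h_tendsto : Tendsto Q.h atTop atTop)
    (hX : ∀ d ∈ Q.efficientPolicies, ∀ n, Q.IsMarkovChain d n (P d n) X)
    (hopt : Q.IsOptimal P X d η) (hg : Q.IsRelativeValue d η g) {j : ℕ} (hj : 0 < j) :
    0 < Q.serviceRate (d j) := by
  have hd := hopt.efficient
  obtain ⟨N, hN⟩ := (h_tendsto.eventually_gt_atTop η).exists_forall_of_atTop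
  have hzero : ∀ j, Q.serviceRate (d j) = 0 → j ≤ N := fun j hj => by
    by_contra! hlt
    exact (hN j hlt.le).not_ge
      (holding_le_of_serviceRate_eq_zero hlam hmu hc h_mono h_convex h_tendsto hX hd hopt.2 hj)
  by_contra hcon
  have hj0 : Q.serviceRate (d j) = 0 := le_antisymm (not_lt.1 hcon) (serviceRate_nonneg hmu _)
  classical
  -- The largest idle state `m` is charged by the limiting law, unlike the states below it, where
  -- `g` carries no information about optimality.
  obtain ⟨m, hjm, hm0, hmax⟩ : ∃ m, j ≤ m ∧ Q.serviceRate (d m) = 0 ∧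
      ∀ i, m < i → 0 < Q.serviceRate (d i) := by
    refine ⟨Nat.findGreatest (fun i => Q.serviceRate (d i) = 0) N,
      Nat.le_findGreatest (hzero j hj0) hj0,
      Nat.findGreatest_spec (P := fun i => Q.serviceRate (d i) = 0) (hzero j hj0) hj0,
      fun i hi => (serviceRate_nonneg hmu _).lt_of_ne' fun hi0 => ?_⟩
    exact hi.not_ge (Nat.le_findGreatest (hzero i hi0) hi0)
  obtain ⟨N', hN'⟩ := hg.eventually_le_succ hlam hmu hc h_mono h_convex h_tendsto hX hd hopt.2 hmax
  have hM : ∃ k, 0 < Q.M k := by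
    by_contra! hM
    have : d (m + 1) = 0 := by
      ext k
      exact Nat.le_zero.1 (((hd (m + 1)).1 k).trans (hM k))
    have h1 := hmax (m + 1) (Nat.lt_succ_self m)
    rw [this, serviceRate_zero] at h1
    exact h1.false
  obtain ⟨k, hk, hρ⟩ := exists_cheapest_group hmu hM
  have hmk := hmu k
  set ρ := Q.c k / Q.mu k with hρdef
  have hρmu : ρ * Q.mu k = Q.c k := div_mul_cancel₀ _ hmk.ne'
  have hdm : d m = 0 := eq_zero_of_serviceRate_eq_zero hmu hm0
  have hγ : Q.lam * (g (m + 1) - g m) = η - Q.h m := by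
    have := hg m
    rw [costRate_eq, generator, hdm, serviceRate_zero, operatingCost_zero] at this
    linarith
  set γ := g (m + 1) - g m with hγdef
  -- If even the cheapest service were not worth its cost at `m`, no service above `m` would pay
  -- either. The increments of `g` would stay below `(η - h i) / lam`, hence become negative,
  -- against eventual monotonicity.
  have hργ : ρ < γ := by
    by_contra! hle
    have hstep : ∀ i, m ≤ i → Q.lam * (g (i + 1) - g i) ≤ η - Q.h i := by
      intro i hi
      induction i, hi using Nat.le_induction with
      | base => exact hγ.le
      | succ i hi ih =>
        have h1 : g (i + 1) - g i ≤ ρ := by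
          refine le_of_mul_le_mul_left ?_ hlam
          have := mul_le_mul_of_nonneg_left hle hlam.le
          linarith [h_mono hi]
        have h2 := mul_le_mul_of_nonneg_left h1 (serviceRate_nonneg hmu (d (i + 1)))
        have h3 := hρ _ _ (hd (i + 1))
        have h4 := hg (i + 1)
        rw [costRate_eq, generator, Nat.add_sub_cancel] at h4
        linarith
    have h1 := hstep (max m (max N N')) (le_max_left _ _)
    have h2 := hN (max m (max N N')) ((le_max_left _ _).trans (le_max_right _ _))
    have h3 := hN' (max m (max N N')) ((le_max_right _ _).trans (le_max_right _ _))
    have h4 := mul_nonneg hlam.le (sub_nonneg.2 h3)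
    linarith
  have hcγ : Q.c k < Q.mu k * γ := by
    rw [← hρmu, mul_comm]
    exact mul_lt_mul_of_pos_left hργ hmk
  -- One server of the cheapest group now works in the states `1, ..., m`. Below `m` the function
  -- `g` is replaced by its linear extension of slope `γ`. There `lam * γ = η - h m` cancels `h n -
  -- η` up to `h n - h m ≤ 0`, leaving the gain `mu k * γ - c k`.
  set d' : Q.Policy := fun n => if 0 < n ∧ n ≤ m then Pi.single k 1 else d n with hd'def
  set g' : ℕ → ℝ := fun n => if n ≤ m then g m - γ * (m - n) else g n with hg'def
  have hd'1 : ∀ n, 0 < n → n ≤ m → d' n = Pi.single k 1 := fun n h1 h2 => if_pos ⟨h1, h2⟩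
  have hd'2 : ∀ n, m < n → d' n = d n := fun n h => if_neg fun h' => h.not_ge h'.2
  have hg'1 : ∀ n, n ≤ m → g' n = g m - γ * (m - n) := fun n h => if_pos h
  have hg'2 : ∀ n, m < n → g' n = g n := fun n h => if_neg h.not_ge
  have hg'm : g' m = g m := by rw [hg'1 m le_rfl]; ring
  have hg'up : ∀ n, n ≤ m → g' (n + 1) - g' n = γ := by
    intro n hn
    rcases hn.eq_or_lt with rfl | hlt
    · rw [hg'2 _ (Nat.lt_succ_self n), hg'm]
    · rw [hg'1 _ hlt, hg'1 _ hn]; push_cast; ring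
  have hdrift : ∀ n, 0 < n → n ≤ m → Q.costRate n (d' n) - η + Q.generator d' g' n ≤
      -(Q.mu k * γ - Q.c k) := by
    intro n h1 h2
    have h3 := hg'up (n - 1) (by omega)
    rw [Nat.sub_add_cancel h1] at h3
    rw [costRate_eq, generator, hd'1 n h1 h2, serviceRate_single, operatingCost_single, hg'up n h2,
      hγ, show g' (n - 1) - g' n = -γ by linarith]
    linarith [h_mono h2]
  refine hopt.not_improvable hlam hmu hc h_mono h_convex h_tendsto hX (d' := d') (g := g')
    (N := max N' (m + 1)) (m := m) (ε := Q.mu k * γ - Q.c k) (fun n => ?_) (fun n hn => ?_)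
    (fun i hi => ?_) (sub_pos.2 hcγ) (fun n hn => ?_) (hdrift m (hj.trans_le hjm) le_rfl)
  · by_cases h : 0 < n ∧ n ≤ m
    · rw [hd'1 n h.1 h.2]
      refine ⟨fun i => ?_, by simpa [Pi.single_apply] using Nat.succ_le_of_lt h.1⟩
      rcases eq_or_ne i k with rfl | hi
      · rw [Pi.single_eq_same]; exact hk
      · rw [Pi.single_eq_of_ne hi]; exact Nat.zero_le _
    · rw [hd'def]
      simp only [if_neg h]
      exact hd n
  · have h1 : m < n := (le_max_right N' (m + 1)).trans hn
    rw [hg'2 n h1, hg'2 (n + 1) (h1.trans (Nat.lt_succ_self n))]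
    exact hN' n ((le_max_left _ _).trans hn)
  · rw [hd'2 i hi]
    exact hmax i hi
  · rcases lt_or_ge m n with h1 | h1
    · have h2 : g' (n - 1) = g (n - 1) := by
        rcases (Nat.le_sub_one_of_lt h1).eq_or_lt with h3 | h3
        · rw [← h3, hg'm]
        · exact hg'2 _ h3
      have h3 := hg n
      rw [generator] at h3
      rw [generator, hd'2 n h1, h2, hg'2 n h1, hg'2 (n + 1) (h1.trans (Nat.lt_succ_self n)), h3]
    · rcases Nat.eq_zero_or_pos n with rfl | h2
      · have h3 : d' 0 = 0 := by
          rw [hd'def]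
          exact (if_neg (by simp)).trans (eq_zero_of_mem_efficientActions_zero (hd 0))
        rw [costRate_eq, generator, h3, serviceRate_zero, operatingCost_zero, hg'up 0 h1, hγ]
        linarith [h_mono h1]
      · linarith [hdrift n h2 h1]

/-- The optimality equation: an optimal policy maximizes the gain in every state. -/
theorem IsOptimal.gain_eq_maxGain (hlam : 0 < Q.lam) (hmu : ∀ k, 0 < Q.mu k)
    (hc : ∀ k, 0 ≤ Q.c k)
    (h_mono : Monotone Q.h) (h_convex : ConvexSeq Q.h) (h_tendsto : Tendsto Q.h atTop atTop)
    (hX : ∀ d ∈ Q.efficientPolicies, ∀ n, Q.IsMarkovChain d n (P d n) X)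
    (hopt : Q.IsOptimal P X d η) (hg : Q.IsRelativeValue d η g) {N : ℕ}
    (hN : ∀ k, N ≤ k → g k ≤ g (k + 1)) (n : ℕ) :
    Q.gain (g n - g (n - 1)) (d n) = Q.maxGain n (g n - g (n - 1)) := by
  have hd := hopt.efficient
  refine le_antisymm (le_maxGain (hd n) _) ?_
  obtain ⟨m, hm, hmg⟩ := exists_gain_eq_maxGain (Q := Q) n (g n - g (n - 1))
  rw [← hmg]
  by_contra! hlt
  -- Only the action in state `n` changes. All states above `n` keep a positive service rate, so `n`
  -- has positive limiting probability under the new policy as well.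
  refine hopt.not_improvable hlam hmu hc h_mono h_convex h_tendsto hX
    (d' := Function.update d n m) (g := g) (m := n) (fun i => ?_) hN (fun j hj => ?_)
    (sub_pos.2 hlt) (fun i hi => ?_) ?_
  · rcases eq_or_ne i n with rfl | hi
    · rwa [Function.update_self]
    · rw [Function.update_of_ne hi]
      exact hd i
  · rw [Function.update_of_ne hj.ne']
    exact hopt.serviceRate_pos hlam hmu hc h_mono h_convex h_tendsto hX hg (by omega)
  · have := hg i
    rw [generator] at this
    rw [generator, Function.update_of_ne hi, this]
  · have := hg n
    rw [generator, costRate_eq] at this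
    rw [generator, costRate_eq, Function.update_self, gain, gain]
    linarith

theorem IsOptimal.monotone_and_convexSeq (hlam : 0 < Q.lam) (hmu : ∀ k, 0 < Q.mu k)
    (hc : ∀ k, 0 ≤ Q.c k)
    (h_mono : Monotone Q.h) (h_convex : ConvexSeq Q.h) (h_tendsto : Tendsto Q.h atTop atTop)
    (hX : ∀ d ∈ Q.efficientPolicies, ∀ n, Q.IsMarkovChain d n (P d n) X)
    (hopt : Q.IsOptimal P X d η) (hg : Q.IsRelativeValue d η g) :
    Monotone g ∧ ConvexSeq g := by
  have hd := hopt.efficient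
  obtain ⟨N, hN⟩ := hg.eventually_le_succ (m := 0) hlam hmu hc h_mono h_convex h_tendsto hX hd hopt.2
    fun j hj => hopt.serviceRate_pos hlam hmu hc h_mono h_convex h_tendsto hX hg hj
  have hd0 := eq_zero_of_mem_efficientActions_zero (hd 0)
  have h0 : Q.h 0 ≤ η := holding_le_of_serviceRate_eq_zero hlam hmu hc h_mono h_convex h_tendsto
    hX hd hopt.2 (j := 0) (by rw [hd0, serviceRate_zero])
  have hG : ∀ n, Q.lam * (g (n + 1) - g (n + 1 - 1)) =
      η - Q.h n + Q.maxGain n (g n - g (n - 1)) := by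
    intro n
    rw [← hopt.gain_eq_maxGain hlam hmu hc h_mono h_convex h_tendsto hX hg hN n, gain]
    have := hg n
    rw [costRate_eq, generator] at this
    rw [Nat.add_sub_cancel]
    linarith
  -- Truncated subtraction makes the increment at `0` vanish, so its monotonicity contains both `0 ≤
  -- g (n + 1) - g n` and convexity.
  have hmono : Monotone fun n => g n - g (n - 1) := by
    refine monotone_of_optimality (N := N + 1) hlam hmu h_convex (by simp) ?_ hG
      fun n hn => ?_
    · have := hG 0
      rw [maxGain_zero] at this
      exact nonneg_of_mul_nonneg_right (by rw [this]; linarith) hlam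
    · have := hN (n - 1) (by omega)
      rw [Nat.sub_add_cancel (by omega : 1 ≤ n)] at this
      exact sub_nonneg.2 this
  refine ⟨monotone_nat_of_le_succ fun n => ?_, fun n => ?_⟩
  · have := hmono (Nat.zero_le (n + 1))
    simp only [Nat.zero_sub, sub_self, Nat.add_sub_cancel] at this
    linarith
  · have := hmono (Nat.le_succ (n + 1))
    simp only [Nat.succ_eq_add_one, Nat.add_sub_cancel] at this
    linarith

end GroupServerQueue

end

theorem theorem4 (Q : GroupServerQueue)
    (hlam : 0 < Q.lam) (hmu : ∀ k, 0 < Q.mu k) (hc : ∀ k, 0 ≤ Q.c k)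
    (h_mono : Monotone Q.h) (h_convex : ConvexSeq Q.h) (h_tendsto : Tendsto Q.h atTop atTop)
    {Ω : Type*} [MeasurableSpace Ω] (P : Q.Policy → ℕ → Measure Ω) (X : ℝ → Ω → ℕ)
    (hX : ∀ d ∈ Q.efficientPolicies, ∀ n, Q.IsMarkovChain d n (P d n) X)
    (dstar : Q.Policy) (ηstar : ℝ) (hopt : Q.IsOptimal P X dstar ηstar)
    (gstar : ℕ → ℝ)
    (hg : Q.IsPotential P X dstar ηstar gstar ∨ Q.IsRelativeValue dstar ηstar gstar) :
    Monotone gstar ∧ ConvexSeq gstar := by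

  refine hopt.monotone_and_convexSeq hlam hmu hc h_mono h_convex h_tendsto hX
    (hg.elim (fun hpot => ?_) id)
  have hΛ := GroupServerQueue.unifRate_pos hlam hmu
  have H := GroupServerQueue.isBirthDeath hlam hmu hopt.efficient
  obtain ⟨hb, hlim⟩ := hopt.hasAverageCost.tendsto_costRate (hX _ hopt.efficient) hc h_mono
    h_convex h_tendsto H hΛ hopt.efficient
  have hsub : (fun n => Q.costRate n (dstar n) - ηstar) =
      (fun n => Q.costRate n (dstar n)) - fun _ => ηstar := rfl
  -- Convergence of the mean cost to `ηstar`, forced by finite average cost, is what turns the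
  -- potential into a solution of the Poisson equation.
  refine hpot.isRelativeValue (hX _ hopt.efficient) H hΛ (fun i => ?_) fun i => ?_
  · obtain ⟨c, hc'⟩ := hb i
    refine ⟨c + |ηstar|, fun l => ?_⟩
    have h1 := H.iterate_le (u := fun n => |Q.costRate n (dstar n) - ηstar|)
      (v := (fun n => |Q.costRate n (dstar n)|) + fun _ => |ηstar|) (fun n => abs_sub _ _) l i
    rw [iterate_map_add, IsBirthDeath.iterate_const] at h1
    exact h1.trans (add_le_add_left (hc' l) _)
  · rw [hsub]
    simp only [iterate_map_sub, IsBirthDeath.iterate_const]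
    simpa using (hlim i).sub_const ηstar
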